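/- Let $s\ge 1$, $\beta\in\mathbb C\setminus\{0\}$, $a,b\in\{1,\dots,s\}$ and $n\ge 0$. **Fock space.** Let $\psi_{c,n},\psi^*_{c,n}$ ($1\le c\le s$, $n\in\mathbb Z$) satisfy $\psi_{c,n}\psi_{d,m}+\psi_{d,m}\psi_{c,n}=0$, $\psi^*_{c,n}\psi^*_{d,m}+\psi^*_{d,m}\psi^*_{c,n}=0$, $\psi_{c,n}\psi^*_{d,m}+\psi^*_{d,m}\psi_{c,n}=\delta_{cd}\delta_{n,-m}$. Let $\mathcal F^s$ be the Fock space generated by the vacuum $|0\rangle$ with $\psi_{c,n}|0\rangle=0$ ($n\ge0$), $\psi^*_{c,m}|0\rangle=0$ ($m>0$), and let $\langle 0|$ be the linear functional on $\mathcal F^s$ with $\langle0|0\rangle=1$, $\langle 0|\psi_{c,n}=0$ ($n<0$), $\langle0|\psi^*_{c,m}=0$ ($m\le0$). Put $\Psi_c(z)=\sum_n\psi_{c,n}z^n$, $\Psi^*_c(z)=\sum_n\psi^*_{c,n}z^{n-1}$ and, with the standard basis $e_1,\dots,e_s$ of $\mathbb C^s$, $\boldsymbol\Psi(z)=\sum_c\Psi_c(z)\otimes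 e_c$. For $|v\rangle\in\mathcal F^s$ and $N\in\mathbb N$ put $$\pi_N|v\rangle=\langle0|\boldsymbol\Psi(z_N)\cdots\boldsymbol\Psi(z_1)|v\rangle=\sum_{c_1,\dots,c_N}\langle 0|\Psi_{c_N}(z_N)\cdots\Psi_{c_1}(z_1)|v\rangle\, e_{c_1}\otimes\cdots\otimes e_{c_N}\in(\mathbb C[z]\otimes\mathbb C^s)^{\otimes N}.$$ **Finite system.** Let $K_{ij}$ exchange the variables $x_i,x_j$, let $P_{ij}$ exchange the $i$-th and $j$-th factors $\mathbb C^s$, and let $\Lambda_-^{s,N}\subset(\mathbb C[z]\otimes\mathbb C^s)^{\otimes N}$ be the space of $f$ with $K_{ij}P_{ij}f=-f$ for all $i\ne j$. Put $\mathcal D^{(N)}_i=x_i\partial_{x_i}+\beta\sum_{j\ne i}\frac{x_i}{x_i-x_j}(1-K_{ij})$, let $E_{ab}e_c=\delta_{bc}e_a$, let $E_{ab,i}$ be $E_{ab}$ acting on the $i$-th factor $\mathbb C^s$, and define $t_{ab,n}$ by $$\delta_{ab}+\beta\sum_{i=1}^N E_{ab,i}\,(\beta u-\mathcal D^{(N)}_i)^{-1}=\delta_{ab}+\sum_{n\ge0}t_{ab,n}u^{-n-1}.$$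 **Operators on the Fock space.** For a formal field $\boldsymbol F(z)=\sum_cF_c(z)\otimes e_c$, whose coefficients are operators on $\mathcal F^s$, put $$\mathcal A(\boldsymbol F)=\frac1{(2\pi i)^2}\int_{z\circlearrowleft0}dz\int_{u\circlearrowleft z}du\,\frac{\sum_c\Psi^*_c(u)F_c(z)}{u-z},\qquad \mathcal E_{ab}\boldsymbol F(z)=F_b(z)\otimes e_a,$$ $$(\mathcal D\boldsymbol F)_c(z)=z\frac{d}{dz}F_c(z)+\frac{\beta z}{(2\pi i)^2}\sum_{d=1}^s\int_{w\circlearrowleft0,\,|w|<|z|}dw\int_{u\circlearrowleft w}du\,\Psi^*_d(u)\,\frac{\Psi_d(w)F_c(z)-\Psi_d(z)F_c(w)}{(u-w)(z-w)}.$$ Here a product $A(x)B(y)$ is the expansion in $|x|<|y|$ of a function with poles of finite order at $x=y$, and is continued analytically to the other regions: two formal series are expansions of the same function in $|x|<|y|$ and in $|y|<|x|$ when, applied to each vector, they lie in $\mathcal F^s((x^{-1}))((y^{-1}))$ and $\mathcal F^s((y^{-1}))((x^{-1}))$ respectively and become equal after multiplication by some power of $y-x$. An integral over $u\circlearrowleft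 z$ is the integral over $|u|>|z|$ minus the one over $|u|<|z|$ (around $0$), and the contours in $\mathcal D$ do not enclose the parameter $z$. Finally put $$T_{ab,n}=\beta^{-n}\mathcal A\,\mathcal E_{ab}\,\mathcal D^n\,\boldsymbol\Psi(z).$$ **Proposition.** $T_{ab,n}$ is a well-defined linear operator on $\mathcal F^s$; for every $N$ one has $t_{ab,n}\Lambda_-^{s,N}\subset\Lambda_-^{s,N}$; and for every $N\in\mathbb N$ and $|v\rangle\in\mathcal F^s$ one has $\pi_N|v\rangle\in\Lambda_-^{s,N}$ and $$\pi_N\big(T_{ab,n}|v\rangle\big)=t_{ab,n}\,\pi_N|v\rangle .$$ That is, $T_{ab,n}$ is a pullback of the Yangian generator $t_{ab,n}$ of the finite spin Calogero–Sutherland system. -/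

import Mathlib

open scoped PowerSeries

noncomputable section

namespace SpinCS

/-! ### The fermionic Fock space -/

/-- The Fock space of `s` free fermion fields: the exterior algebra on the creation modes.
The basis vector `Sum.inl (c, k)` is the mode `ψ_{c,-k-1}`, the basis vector `Sum.inr (c, k)` is
the mode `ψ*_{c,-k}`; the vacuum `|0⟩` is `1`. -/
abbrev FockSpace (s : ℕ) : Type :=
  ExteriorAlgebra ℂ ((Fin s × ℕ) ⊕ (Fin s × ℕ) →₀ ℂ)

/-- Multiplication by a creation mode. -/
def create {s : ℕ} (g : (Fin s × ℕ) ⊕ (Fin s × ℕ)) : Module.End ℂ (FockSpace s) :=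
  LinearMap.mulLeft ℂ (ExteriorAlgebra.ι ℂ (Finsupp.single g 1))

/-- Contraction with a creation mode (the antiderivation dual to `create g`). -/
def annihilate {s : ℕ} (g : (Fin s × ℕ) ⊕ (Fin s × ℕ)) : Module.End ℂ (FockSpace s) :=
  CliffordAlgebra.contractLeft
    (Q := (0 : QuadraticForm ℂ ((Fin s × ℕ) ⊕ (Fin s × ℕ) →₀ ℂ))) (Finsupp.lapply g)

/-- The fermion mode `ψ_{c,n}`. -/
def psi {s : ℕ} (c : Fin s) : ℤ → Module.End ℂ (FockSpace s)
  | Int.ofNat k => annihilate (Sum.inr (c, k))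
  | Int.negSucc k => create (Sum.inl (c, k))

/-- The fermion mode `ψ*_{c,-n}`, as a function of `n`. -/
def psiStarNeg {s : ℕ} (c : Fin s) : ℤ → Module.End ℂ (FockSpace s)
  | Int.ofNat k => create (Sum.inr (c, k))
  | Int.negSucc k => annihilate (Sum.inl (c, k))

/-- The fermion mode `ψ*_{c,n}`. -/
def psiStar {s : ℕ} (c : Fin s) (n : ℤ) : Module.End ℂ (FockSpace s) := psiStarNeg c (-n)

/-- The left vacuum `⟨0|`, normalized by `⟨0|0⟩ = 1`. -/
def leftVacuum (s : ℕ) : FockSpace s →ₗ[ℂ] ℂ :=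
  (ExteriorAlgebra.algebraMapInv (R := ℂ)
    (M := (Fin s × ℕ) ⊕ (Fin s × ℕ) →₀ ℂ)).toLinearMap

lemma create_create {s : ℕ} (g h : (Fin s × ℕ) ⊕ (Fin s × ℕ)) :
    create g * create h + create h * create g = 0 := by
  refine LinearMap.ext fun v => ?_
  have := ExteriorAlgebra.ι_add_mul_swap (R := ℂ) (Finsupp.single g (1 : ℂ)) (Finsupp.single h 1)
  simp only [create, LinearMap.add_apply, Module.End.mul_apply, LinearMap.mulLeft_apply,
    ← mul_assoc, ← add_mul, this, zero_mul, LinearMap.zero_apply]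

lemma annihilate_annihilate {s : ℕ} (g h : (Fin s × ℕ) ⊕ (Fin s × ℕ)) :
    annihilate g * annihilate h + annihilate h * annihilate g = 0 := by
  refine LinearMap.ext fun v => ?_
  simp only [annihilate, LinearMap.add_apply, Module.End.mul_apply, LinearMap.zero_apply]
  rw [CliffordAlgebra.contractLeft_comm, neg_add_cancel]

lemma annihilate_create {s : ℕ} (g h : (Fin s × ℕ) ⊕ (Fin s × ℕ)) :
    annihilate g * create h + create h * annihilate g = if g = h then 1 else 0 := by
  refine LinearMap.ext fun v => ?_
  simp only [annihilate, create, LinearMap.add_apply, Module.End.mul_apply,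
    LinearMap.mulLeft_apply]
  rw [show ExteriorAlgebra.ι ℂ (Finsupp.single h (1 : ℂ)) =
    CliffordAlgebra.ι (0 : QuadraticForm ℂ ((Fin s × ℕ) ⊕ (Fin s × ℕ) →₀ ℂ))
      (Finsupp.single h 1) from rfl, CliffordAlgebra.contractLeft_ι_mul, sub_add_cancel]
  by_cases hgh : g = h
  · subst hgh; simp
  · simp [hgh]

lemma psi_psi {s : ℕ} (a b : Fin s) (n m : ℤ) : psi a n * psi b m + psi b m * psi a n = 0 := by
  rcases n with n | n <;> rcases m with m | m <;> simp only [psi]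
  · exact annihilate_annihilate _ _
  · simp [annihilate_create]
  · rw [add_comm]; simp [annihilate_create]
  · exact create_create _ _

lemma psiStar_psiStar {s : ℕ} (a b : Fin s) (n m : ℤ) :
    psiStar a n * psiStar b m + psiStar b m * psiStar a n = 0 := by
  unfold psiStar
  rcases -n with n | n <;> rcases -m with m | m <;> simp only [psiStarNeg]
  · exact create_create _ _
  · rw [add_comm]; simp [annihilate_create]
  · simp [annihilate_create]
  · exact annihilate_annihilate _ _

lemma psi_psiStar {s : ℕ} (a b : Fin s) (n m : ℤ) :
    psi a n * psiStar b m + psiStar b m * psi a n = if a = b ∧ n = -m then 1 else 0 := by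
  unfold psiStar
  rcases n with n | n <;> rcases -m with m | m <;> simp only [psi, psiStarNeg]
  · simp [annihilate_create]
  · simp [annihilate_annihilate]
  · simp [create_create]
  · rw [add_comm, annihilate_create]
    simp [eq_comm]

lemma leftVacuum_vacuum (s : ℕ) : leftVacuum s 1 = 1 := by
  simp [leftVacuum]

lemma psi_vacuum {s : ℕ} (c : Fin s) (n : ℤ) (hn : 0 ≤ n) : psi c n 1 = 0 := by
  obtain ⟨k, rfl⟩ := Int.eq_ofNat_of_zero_le hn
  exact CliffordAlgebra.contractLeft_one (Q := 0) _

lemma psiStar_vacuum {s : ℕ} (c : Fin s) (n : ℤ) (hn : 0 < n) : psiStar c n 1 = 0 := by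
  obtain ⟨k, hk⟩ := Int.eq_negSucc_of_lt_zero (neg_lt_zero.mpr hn)
  unfold psiStar
  rw [hk]
  exact CliffordAlgebra.contractLeft_one (Q := 0) _

lemma leftVacuum_psi {s : ℕ} (c : Fin s) (n : ℤ) (hn : n < 0) (v : FockSpace s) :
    leftVacuum s (psi c n v) = 0 := by
  obtain ⟨k, rfl⟩ := Int.eq_negSucc_of_lt_zero hn
  simp [psi, create, leftVacuum, ExteriorAlgebra.algebraMapInv]

lemma leftVacuum_psiStar {s : ℕ} (c : Fin s) (n : ℤ) (hn : n ≤ 0) (v : FockSpace s) :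
    leftVacuum s (psiStar c n v) = 0 := by
  obtain ⟨k, hk⟩ := Int.eq_ofNat_of_zero_le (neg_nonneg.mpr hn)
  unfold psiStar
  rw [hk]
  change leftVacuum s (create (Sum.inr (c, k)) v) = 0
  simp [create, leftVacuum, ExteriorAlgebra.algebraMapInv]

lemma exists_psi_eq_zero {s : ℕ} (v : FockSpace s) : ∃ K : ℤ, ∀ c n, K < n → psi c n v = 0 := by
  induction v using CliffordAlgebra.left_induction with
  | algebraMap r =>
    refine ⟨0, fun c n hn => ?_⟩
    obtain ⟨k, rfl⟩ := Int.eq_ofNat_of_zero_le hn.le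
    exact CliffordAlgebra.contractLeft_algebraMap (Q := 0) _ _
  | add x y hx hy =>
    obtain ⟨K, hK⟩ := hx
    obtain ⟨L, hL⟩ := hy
    refine ⟨max K L, fun c n hn => ?_⟩
    rw [map_add, hK c n (lt_of_le_of_lt (le_max_left _ _) hn),
      hL c n (lt_of_le_of_lt (le_max_right _ _) hn), add_zero]
  | ι_mul x m hx =>
    obtain ⟨K, hK⟩ := hx
    obtain ⟨B, hB⟩ : ∃ B : ℕ, ∀ c k, B < k → m (Sum.inr (c, k)) = 0 := by
      refine ⟨m.support.sup (Sum.elim Prod.snd Prod.snd), fun c k hk => ?_⟩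
      by_contra h
      exact absurd (Finset.le_sup (f := Sum.elim Prod.snd Prod.snd)
        (Finsupp.mem_support_iff.mpr h)) (not_le.mpr hk)
    refine ⟨max K B, fun c n hn => ?_⟩
    obtain ⟨k, rfl⟩ := Int.eq_ofNat_of_zero_le (le_trans (by positivity)
      (le_trans (le_max_right K (B : ℤ)) hn.le))
    have h1 := hK c k (lt_of_le_of_lt (le_max_left _ _) hn)
    have h2 := hB c k (by exact_mod_cast lt_of_le_of_lt (le_max_right K (B : ℤ)) hn)
    change annihilate (Sum.inr (c, k)) x = 0 at h1
    change annihilate (Sum.inr (c, k)) _ = 0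
    unfold annihilate at h1 ⊢
    rw [CliffordAlgebra.contractLeft_ι_mul, h1, Finsupp.lapply_apply, h2]
    simp

/-! ### The finite system -/

/-- `(ℂ[z] ⊗ ℂ^s)^{⊗ N} = ℂ[x_1, …, x_N] ⊗ (ℂ^s)^{⊗ N}`: the polynomial `f c` is the coefficient
of `e_{c_1} ⊗ ⋯ ⊗ e_{c_N}`. -/
abbrev SpinTensor (s N : ℕ) : Type := (Fin N → Fin s) → MvPolynomial (Fin N) ℂ

/-- The space of skew-invariants: `K_{ij} P_{ij} f = - f` for all `i ≠ j`, where `K_{ij}` exchanges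
the variables and `P_{ij}` the tensor factors `ℂ^s`. -/
def skewInvariants (s N : ℕ) : Set (SpinTensor s N) :=
  {f | ∀ i j : Fin N, i ≠ j → ∀ c : Fin N → Fin s,
    MvPolynomial.rename (Equiv.swap i j) (f (c ∘ Equiv.swap i j)) = - f c}

lemma sub_dvd_sub_exchange {N : ℕ} (i j : Fin N) (f : MvPolynomial (Fin N) ℂ) :
    (MvPolynomial.X i - MvPolynomial.X j : MvPolynomial (Fin N) ℂ) ∣
      f - MvPolynomial.rename (Equiv.swap i j) f := by
  rw [← Ideal.mem_span_singleton, ← Ideal.Quotient.eq]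
  set I := Ideal.span {(MvPolynomial.X i - MvPolynomial.X j : MvPolynomial (Fin N) ℂ)}
  have hij : Ideal.Quotient.mk I (MvPolynomial.X i) = Ideal.Quotient.mk I (MvPolynomial.X j) :=
    Ideal.Quotient.eq.mpr (Ideal.mem_span_singleton_self _)
  have h : Ideal.Quotient.mkₐ ℂ I =
      (Ideal.Quotient.mkₐ ℂ I).comp (MvPolynomial.rename (Equiv.swap i j)) := by
    apply MvPolynomial.algHom_ext
    intro k
    simp only [AlgHom.comp_apply, MvPolynomial.rename_X, Ideal.Quotient.mkₐ_eq_mk]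
    rcases eq_or_ne k i with rfl | hki
    · rw [Equiv.swap_apply_left, hij]
    rcases eq_or_ne k j with rfl | hkj
    · rw [Equiv.swap_apply_right, hij]
    rw [Equiv.swap_apply_of_ne_of_ne hki hkj]
  exact DFunLike.congr_fun h f

/-- The polynomial `(f - K_{ij} f) / (x_i - x_j)`. -/
def exchangeQuotientFun {N : ℕ} (i j : Fin N) (f : MvPolynomial (Fin N) ℂ) :
    MvPolynomial (Fin N) ℂ :=
  Classical.choose (sub_dvd_sub_exchange i j f)

lemma exchangeQuotientFun_spec {N : ℕ} (i j : Fin N) (f : MvPolynomial (Fin N) ℂ) :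
    f - MvPolynomial.rename (Equiv.swap i j) f =
      (MvPolynomial.X i - MvPolynomial.X j) * exchangeQuotientFun i j f :=
  Classical.choose_spec (sub_dvd_sub_exchange i j f)

lemma X_sub_X_ne_zero {N : ℕ} {i j : Fin N} (hij : i ≠ j) :
    (MvPolynomial.X i - MvPolynomial.X j : MvPolynomial (Fin N) ℂ) ≠ 0 :=
  sub_ne_zero.mpr fun h => hij (MvPolynomial.X_injective h)

/-- The linear operator `(1 - K_{ij}) / (x_i - x_j)` on polynomials, `i ≠ j`. -/
def exchangeQuotient {N : ℕ} (i j : Fin N) (hij : i ≠ j) :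
    MvPolynomial (Fin N) ℂ →ₗ[ℂ] MvPolynomial (Fin N) ℂ where
  toFun := exchangeQuotientFun i j
  map_add' f g := by
    apply mul_left_cancel₀ (X_sub_X_ne_zero hij)
    rw [mul_add, ← exchangeQuotientFun_spec, ← exchangeQuotientFun_spec,
      ← exchangeQuotientFun_spec, map_add]
    ring
  map_smul' r f := by
    apply mul_left_cancel₀ (X_sub_X_ne_zero hij)
    rw [RingHom.id_apply, mul_smul_comm, ← exchangeQuotientFun_spec,
      ← exchangeQuotientFun_spec, map_smul, smul_sub]

/-- The Dunkl operator `D_i = x_i ∂/∂x_i + β ∑_{j ≠ i} x_i / (x_i - x_j) (1 - K_{ij})` on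
polynomials. -/
def dunklPoly {N : ℕ} (β : ℂ) (i : Fin N) :
    MvPolynomial (Fin N) ℂ →ₗ[ℂ] MvPolynomial (Fin N) ℂ :=
  LinearMap.mulLeft ℂ (MvPolynomial.X i) ∘ₗ (MvPolynomial.pderiv i).toLinearMap +
    β • ∑ j : {j : Fin N // j ≠ i},
      LinearMap.mulLeft ℂ (MvPolynomial.X i) ∘ₗ exchangeQuotient i j.1 j.2.symm

/-- The Dunkl operator on spin tensors; it does not act on the spins. -/
def dunkl (s : ℕ) {N : ℕ} (β : ℂ) (i : Fin N) : Module.End ℂ (SpinTensor s N) :=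
  (dunklPoly β i).compLeft (Fin N → Fin s)

/-- The matrix unit `E_{ab}`, `E_{ab} e_c = δ_{bc} e_a`, acting on the `i`-th factor `ℂ^s`. -/
def matrixUnit {s N : ℕ} (a b : Fin s) (i : Fin N) : Module.End ℂ (SpinTensor s N) where
  toFun f c := if c i = a then f (Function.update c i b) else 0
  map_add' f g := by ext1 c; by_cases h : c i = a <;> simp [h]
  map_smul' r f := by ext1 c; by_cases h : c i = a <;> simp [h]

/-- The generating series `t_{ab}(u) = δ_{ab} + β ∑_i E_{ab,i} (β u - D_i)⁻¹` as a power series in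
`X = u⁻¹`; here `(β u - D_i)⁻¹ = X (β - D_i X)⁻¹`. -/
def yangianSeries {s : ℕ} (N : ℕ) (β : ℂˣ) (a b : Fin s) : (Module.End ℂ (SpinTensor s N))⟦X⟧ :=
  (if a = b then 1 else 0) + ∑ i : Fin N, PowerSeries.C ((β : ℂ) • matrixUnit a b i) *
    (PowerSeries.X * PowerSeries.invOfUnit
      (PowerSeries.C (algebraMap ℂ (Module.End ℂ (SpinTensor s N)) β) -
        PowerSeries.C (dunkl s (β : ℂ) i) * PowerSeries.X)
      (Units.map (algebraMap ℂ (Module.End ℂ (SpinTensor s N))).toMonoidHom β))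

/-- The Yangian generator `t_{ab,n}`, where `t_{ab}(u) = δ_{ab} + ∑_{n ≥ 0} t_{ab,n} u^{-n-1}`. -/
def yangianGenerator {s : ℕ} (N : ℕ) (β : ℂˣ) (a b : Fin s) (n : ℕ) :
    Module.End ℂ (SpinTensor s N) :=
  PowerSeries.coeff (n + 1) (yangianSeries N β a b)

/-! ### Matrix elements -/

/-- The product `ψ_{c_N,n_N} ⋯ ψ_{c_1,n_1}`. -/
def psiWord {s N : ℕ} (c : Fin N → Fin s) (n : Fin N → ℤ) : Module.End ℂ (FockSpace s) :=
  (List.ofFn fun i => psi (c i) (n i)).reverse.prod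

/-- `π_N |v⟩ = ⟨0| Ψ(x_N) ⋯ Ψ(x_1) |v⟩`, where `Ψ(x) = ∑_c Ψ_c(x) ⊗ e_c`,
`Ψ_c(x) = ∑_{n ∈ ℤ} ψ_{c,n} x^n`. By the lemmas below the coefficients with a negative exponent
vanish and only finitely many coefficients are nonzero. -/
def matrixElement {s : ℕ} (N : ℕ) (v : FockSpace s) : SpinTensor s N := fun c =>
  ∑ᶠ m : Fin N →₀ ℕ, MvPolynomial.monomial m (leftVacuum s (psiWord c (fun i => (m i : ℤ)) v))

lemma prod_mul_psi {s : ℕ} (l : List (Fin s × ℤ)) (d : Fin s) (m : ℤ) :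
    (l.map fun p => psi p.1 p.2).prod * psi d m = psi d m * (l.map fun p => psi p.1 p.2).prod ∨
    (l.map fun p => psi p.1 p.2).prod * psi d m +
      psi d m * (l.map fun p => psi p.1 p.2).prod = 0 := by
  induction l with
  | nil => simp
  | cons p l ih =>
    have h := psi_psi p.1 d p.2 m
    rw [List.map_cons, List.prod_cons]
    set P := psi p.1 p.2
    set D := psi d m
    set L := (l.map fun p => psi p.1 p.2).prod
    have h1 : P * D * L + D * P * L = 0 := by rw [← add_mul, h, zero_mul]
    rcases ih with ih | ih
    · right
      rw [mul_assoc, ih, ← mul_assoc, ← mul_assoc, h1]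
    · left
      have h2 : P * L * D + P * D * L = 0 := by
        rw [mul_assoc, mul_assoc, ← mul_add, ih, mul_zero]
      rw [← mul_assoc]
      exact add_right_cancel (h2.trans (by rw [add_comm, h1]))

lemma psiWord_eq {s N : ℕ} (c : Fin N → Fin s) (n : Fin N → ℤ) (i : Fin N) :
    ∃ (l r : List (Fin s × ℤ)), psiWord c n =
      (l.map fun p => psi p.1 p.2).prod * (psi (c i) (n i) * (r.map fun p => psi p.1 p.2).prod) := by
  have h : (c i, n i) ∈ (List.ofFn fun i => (c i, n i)).reverse :=
    List.mem_reverse.mpr (List.mem_ofFn.mpr ⟨i, rfl⟩)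
  obtain ⟨l, r, hlr⟩ := List.append_of_mem h
  refine ⟨l, r, ?_⟩
  have : psiWord c n = (((List.ofFn fun i => (c i, n i)).reverse).map
      fun p => psi p.1 p.2).prod := by
    rw [psiWord, List.map_reverse, List.map_ofFn]
    rfl
  rw [this, hlr]
  simp

lemma leftVacuum_psiWord_of_neg {s N : ℕ} (c : Fin N → Fin s) (n : Fin N → ℤ) (v : FockSpace s)
    (i : Fin N) (hi : n i < 0) : leftVacuum s (psiWord c n v) = 0 := by
  obtain ⟨l, r, h⟩ := psiWord_eq c n i
  rw [h, ← mul_assoc]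
  have h1 := leftVacuum_psi (c i) (n i) hi ((l.map fun p => psi p.1 p.2).prod
    ((r.map fun p => psi p.1 p.2).prod v))
  rcases prod_mul_psi l (c i) (n i) with h | h
  · rw [h]
    exact h1
  · have h2 := congrArg (leftVacuum s) (LinearMap.congr_fun h ((r.map fun p => psi p.1 p.2).prod v))
    simpa [h1] using h2

lemma psiWord_of_large {s N : ℕ} (c : Fin N → Fin s) (n : Fin N → ℤ) (v : FockSpace s)
    (i : Fin N) (hi : psi (c i) (n i) v = 0) : psiWord c n v = 0 := by
  obtain ⟨l, r, h⟩ := psiWord_eq c n i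
  have h2 : (psi (c i) (n i) * (r.map fun p => psi p.1 p.2).prod) v = 0 := by
    rcases prod_mul_psi r (c i) (n i) with h | h
    · rw [← h, Module.End.mul_apply, hi, map_zero]
    · simpa [hi] using LinearMap.congr_fun h v
  rw [h, Module.End.mul_apply, h2, map_zero]

lemma finite_support_psiWord {s N : ℕ} (c : Fin N → Fin s) (v : FockSpace s) :
    {n : Fin N → ℤ | leftVacuum s (psiWord c n v) ≠ 0}.Finite := by
  obtain ⟨K, hK⟩ := exists_psi_eq_zero v
  refine (Set.finite_Icc (0 : Fin N → ℤ) (fun _ => K)).subset fun n hn => ⟨fun i => ?_, fun i => ?_⟩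
  · by_contra h
    exact hn (leftVacuum_psiWord_of_neg c n v i (not_le.mp h))
  · by_contra h
    exact hn (by rw [psiWord_of_large c n v i (hK _ _ (not_le.mp h)), map_zero])

lemma coeff_matrixElement {s : ℕ} (N : ℕ) (v : FockSpace s) (c : Fin N → Fin s)
    (m : Fin N →₀ ℕ) : MvPolynomial.coeff m (matrixElement N v c) =
      leftVacuum s (psiWord c (fun i => (m i : ℤ)) v) := by
  have hinj : Function.Injective fun (m : Fin N →₀ ℕ) (i : Fin N) => (m i : ℤ) := by
    intro a b h
    ext i
    exact Int.ofNat.inj (congrFun h i)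
  have hfin : (Function.support fun m : Fin N →₀ ℕ => MvPolynomial.monomial m
      (leftVacuum s (psiWord c (fun i => (m i : ℤ)) v))).Finite := by
    refine ((finite_support_psiWord c v).preimage hinj.injOn).subset fun m hm h => hm ?_
    change leftVacuum s (psiWord c (fun i => (m i : ℤ)) v) = 0 at h
    simp only [h, map_zero]
  rw [matrixElement, finsum_eq_sum _ hfin, MvPolynomial.coeff_sum]
  simp only [MvPolynomial.coeff_monomial, Finset.sum_ite_eq']
  split_ifs with h
  · rfl
  · by_contra h2
    refine h (hfin.mem_toFinset.mpr ?_)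
    simpa using Ne.symm h2

/-! ### Formal series in two variables, analytic continuation and contour integrals

A formal series `∑ S p q x^p y^q` with coefficients in a vector space is written
`S : ℤ → ℤ → E`. -/

section Series

variable {E : Type*} [AddCommGroup E]

/-- `S ∈ E((x⁻¹))((y⁻¹))`: the shape of an expansion in the region `|x| < |y|` of a function of
`x, y` with poles of finite order at `x = y`. Such an expansion is determined by the function. -/
def IsExpansion (S : ℤ → ℤ → E) : Prop :=
  (∃ Y : ℤ, ∀ p q, Y < q → S p q = 0) ∧ ∀ q, ∃ X : ℤ, ∀ p, X < p → S p q = 0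

/-- Multiplication of a series by `y - x`. -/
def mulDiff (S : ℤ → ℤ → E) : ℤ → ℤ → E := fun p q => S p (q - 1) - S (p - 1) q

/-- `S` and `S'` are the expansions, in the regions `|x| < |y|` and `|y| < |x|` respectively, of one
and the same function with a pole of finite order at `x = y`; that is, `S'` is the analytic
continuation of `S`. -/
def IsContinuation (S S' : ℤ → ℤ → E) : Prop :=
  IsExpansion S ∧ IsExpansion (fun q p => S' p q) ∧
    ∃ M : ℕ, mulDiff^[M] S = mulDiff^[M] S'

/-- `Δ` is the expansion in the region `|x| < |y|` of the function `(f - g) / (y - x)`, where `f` is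
given by its expansion `S` in the region `|x| < |y|`, `g` is given by its expansion `S'` in the
region `|y| < |x|`, and the functions have poles of finite order at `x = y`. -/
def IsDividedDifference (S S' Δ : ℤ → ℤ → E) : Prop :=
  IsExpansion S ∧ IsExpansion (fun q p => S' p q) ∧ IsExpansion Δ ∧
    ∃ M : ℕ, mulDiff^[M + 1] Δ = mulDiff^[M] (S - S')

/-- The integral `(2πi)⁻² ∮_{z ↻ 0} dz ∮_{u ↻ z} du f(u, z) / (u - z)`, where `S` and `S'` are the
expansions of `f` in `|u| < |z|` and in `|z| < |u|`. The contour of `u` around `z` is the difference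
of a contour with `|u| > |z|`, where `(u - z)⁻¹ = ∑_{i ≥ 0} z^i u^{-i-1}`, and a contour with
`|u| < |z|`, where `(u - z)⁻¹ = - ∑_{i ≥ 0} u^i z^{-i-1}`. The sums are finite for `S`, `S'` as in
`IsContinuation`. -/
def contourIntegral (S S' : ℤ → ℤ → E) : E :=
  ∑ᶠ i : ℕ, S' i (-1 - i) + ∑ᶠ i : ℕ, S (-1 - i) i

end Series

/-! ### The pullback operators -/

/-- A formal field `F(z) = ∑_c ∑_{n ∈ ℤ} F c n z^n ⊗ e_c` with operator coefficients. -/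
abbrev FormalField (s : ℕ) : Type := Fin s → ℤ → Module.End ℂ (FockSpace s)

/-- The integral
`𝒜(F) = (2πi)⁻² ∮_{z ↻ 0} dz ∮_{u ↻ z} du (∑_c Ψ*_c(u) F_c(z)) / (u - z)`, where
`Ψ*_c(u) = ∑_n ψ*_{c,n} u^{n-1}`: the product `Ψ*_c(u) F_c(z)` is an expansion in `|u| < |z|`, and
`C c` is its continuation to `|z| < |u|`. -/
def IsAntisymmetrizer {s : ℕ} (F : FormalField s) (A : Module.End ℂ (FockSpace s)) : Prop :=
  ∃ C : Fin s → ℤ → ℤ → Module.End ℂ (FockSpace s),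
    (∀ c v, IsContinuation (fun p q => psiStar c (p + 1) (F c q v)) (fun p q => C c p q v)) ∧
    ∀ v, A v = ∑ c, contourIntegral
      (fun p q => psiStar c (p + 1) (F c q v)) (fun p q => C c p q v)

/-- `G = 𝒟 F`, where in components
`(𝒟 F)_c(z) = z ∂_z F_c(z) + β z (2πi)⁻² ∑_b ∮_{w ↻ 0, |w| < |z|} dw ∮_{u ↻ w} du
    Ψ*_b(u) (Ψ_b(w) F_c(z) - Ψ_b(z) F_c(w)) / ((u - w) (z - w))`.
The fraction `(Ψ_b(w) F_c(z) - Ψ_b(z) F_c(w)) / (z - w)` is expanded in `|w| < |z|` as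
`∑_{m,k} Δ c b m k w^m z^k`; the contours do not enclose the parameter `z`, so that the double
integral is taken for each power of `z` separately. -/
def IsDunklPullback {s : ℕ} (β : ℂ) (F G : FormalField s) : Prop :=
  ∃ (Δ : Fin s → Fin s → ℤ → ℤ → Module.End ℂ (FockSpace s))
    (A : Fin s → ℤ → Module.End ℂ (FockSpace s)),
    (∀ c b v, IsDividedDifference (fun m k => psi b m (F c k v)) (fun m k => psi b k (F c m v))
      (fun m k => Δ c b m k v)) ∧
    (∀ c k, IsAntisymmetrizer (fun b m => Δ c b m k) (A c k)) ∧
    ∀ c n, G c n = (n : ℂ) • F c n + β • A c (n - 1)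

/-- `E_{ab} F(z) = F_b(z) ⊗ e_a`. -/
def fieldMatrixUnit {s : ℕ} (a b : Fin s) (F : FormalField s) : FormalField s :=
  fun c => if c = a then F b else 0

/-- `T = T_{ab,n} = β^{-n} 𝒜 E_{ab} 𝒟^n Ψ(z)`. -/
def IsYangianOperator {s : ℕ} (β : ℂˣ) (a b : Fin s) (n : ℕ)
    (T : Module.End ℂ (FockSpace s)) : Prop :=
  ∃ (G : ℕ → FormalField s) (A : Module.End ℂ (FockSpace s)),
    G 0 = psi ∧ (∀ k < n, IsDunklPullback (β : ℂ) (G k) (G (k + 1))) ∧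
    IsAntisymmetrizer (fieldMatrixUnit a b (G n)) A ∧ T = ((β : ℂ) ^ n)⁻¹ • A

end SpinCS

end

/-! The analytic content is carried by one class of series, `RegularSeries`: starting from the
vacuum, one multiplies by `z`, applies creation modes, and multiplies by derivatives of the creation
parts of the fields `Ψ_c(z)`. For `φ` in this class, `Ψ_b(w) φ(z)` has no pole at `w = z`, since the
`ψ` modes anticommute. The product `Ψ*_b(u) φ(z)` has a pole of finite order at `u = z`, produced by
contracting `ψ*` with those derivatives (`RegularSeries.exists_polarDecomposition`). So the
continuations and divided differences exist, and the double integral in `𝒟` is again regular in `z`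
(`RegularSeries.contourIntegral`). Hence every `𝒟^k Ψ(z)|v⟩` is componentwise regular and `T_{ab,n}`
exists. Uniqueness, and with it linearity in the vector, comes from the injectivity of
multiplication by `y - x` on expansions in a fixed region.

For the intertwining relation, negative powers of `z` in a regular series come only from creation
parts of the `Ψ_c`, which vanish under `⟨0|Ψ⋯Ψ` (`RegularSeries.leftVacuum_psiWord`). In a matrix
element of `𝒜(F)` this kills the contour `|u| > |z|`. The other contour contains only creation modes
`ψ*_{c,-i}`, and Wick contraction replaces each factor `Ψ(x_l)` in turn by `F(x_l)`
(`IsAntisymmetrizer.leftVacuum_psiWord`). Applied to the divided difference inside `𝒟`, the same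
formula yields `∑_{l ≠ j} (1 - K_{jl}) / (x_j - x_l)`; the quotients agree because both have the
same product with `x_j - x_l`. Thus `𝒟` in slot `j` is the Dunkl operator `D_j`
(`IsDunklPullback.intCoeff_dunklPoly`), and `𝒜 E_{ab} 𝒟^n` becomes `∑_j E_{ab,j} D_j^n`. By the
geometric series this is `β^n t_{ab,n}`.

Skew-invariance of matrix elements is the anticommutation of the fermions; `t_{ab,n}` preserves it
because permuting the variables permutes the Dunkl operators. -/

noncomputable section

namespace SpinCS

/-! ### Formal series in two variables -/

section Series

variable {E E' : Type*} [AddCommGroup E] [AddCommGroup E']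

/-- Multiplication by `y - x` as an additive map. -/
def mulDiffHom : (ℤ → ℤ → E) →+ (ℤ → ℤ → E) where
  toFun := mulDiff
  map_zero' := by ext; simp [mulDiff]
  map_add' S T := by ext; simp only [mulDiff, Pi.add_apply]; abel

lemma mulDiff_iterate_zero (M : ℕ) : mulDiff^[M] (0 : ℤ → ℤ → E) = 0 :=
  iterate_map_zero (mulDiffHom (E := E)) M

lemma mulDiff_iterate_add (M : ℕ) (S T : ℤ → ℤ → E) :
    mulDiff^[M] (S + T) = mulDiff^[M] S + mulDiff^[M] T :=
  iterate_map_add (mulDiffHom (E := E)) M S T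

lemma mulDiff_iterate_sub (M : ℕ) (S T : ℤ → ℤ → E) :
    mulDiff^[M] (S - T) = mulDiff^[M] S - mulDiff^[M] T :=
  iterate_map_sub (mulDiffHom (E := E)) M S T

lemma mulDiff_iterate_sum {ι : Type*} (t : Finset ι) (M : ℕ) (S : ι → ℤ → ℤ → E) :
    mulDiff^[M] (∑ i ∈ t, S i) = ∑ i ∈ t, mulDiff^[M] (S i) := by
  classical
  induction t using Finset.induction_on with
  | empty => simpa using mulDiff_iterate_zero M
  | insert a t ha ih => rw [Finset.sum_insert ha, Finset.sum_insert ha, mulDiff_iterate_add, ih]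

lemma mulDiff_map (f : E →+ E') (S : ℤ → ℤ → E) :
    mulDiff (fun p q => f (S p q)) = fun p q => f (mulDiff S p q) := by
  ext p q
  simp [mulDiff]

lemma mulDiff_iterate_map (f : E →+ E') (M : ℕ) (S : ℤ → ℤ → E) :
    mulDiff^[M] (fun p q => f (S p q)) = fun p q => f (mulDiff^[M] S p q) := by
  induction M generalizing S with
  | zero => rfl
  | succ M ih => rw [Function.iterate_succ_apply, mulDiff_map, ih, Function.iterate_succ_apply]

lemma mulDiff_iterate_shift (a b : ℤ) (M : ℕ) (S : ℤ → ℤ → E) :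
    mulDiff^[M] (fun p q => S (p - a) (q - b)) = fun p q => mulDiff^[M] S (p - a) (q - b) := by
  induction M generalizing S with
  | zero => rfl
  | succ M ih =>
    rw [Function.iterate_succ_apply, Function.iterate_succ_apply, ← ih]
    congr 1
    ext p q
    simp only [mulDiff]
    rw [sub_right_comm q, sub_right_comm p]

lemma mulDiff_iterate_congr_of_le {S T : ℤ → ℤ → E} {M N : ℕ} (hMN : M ≤ N)
    (h : mulDiff^[M] S = mulDiff^[M] T) : mulDiff^[N] S = mulDiff^[N] T := by
  obtain ⟨k, rfl⟩ := Nat.exists_eq_add_of_le' hMN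
  rw [Function.iterate_add_apply, Function.iterate_add_apply, h]

/-! ### Expansions, and the injectivity of multiplication by `y - x`. -/

lemma IsExpansion.zero : IsExpansion (0 : ℤ → ℤ → E) :=
  ⟨⟨0, fun _ _ _ => rfl⟩, fun _ => ⟨0, fun _ _ => rfl⟩⟩

lemma IsExpansion.add {S T : ℤ → ℤ → E} (hS : IsExpansion S) (hT : IsExpansion T) :
    IsExpansion (S + T) := by
  obtain ⟨⟨Y, hY⟩, hX⟩ := hS
  obtain ⟨⟨Y', hY'⟩, hX'⟩ := hT
  refine ⟨⟨max Y Y', fun p q h => ?_⟩, fun q => ?_⟩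
  · rw [Pi.add_apply, Pi.add_apply, hY p q (by omega), hY' p q (by omega), add_zero]
  · obtain ⟨X, hX⟩ := hX q
    obtain ⟨X', hX'⟩ := hX' q
    exact ⟨max X X', fun p h => by
      rw [Pi.add_apply, Pi.add_apply, hX p (by omega), hX' p (by omega), add_zero]⟩

lemma IsExpansion.map {S : ℤ → ℤ → E} (f : E →+ E') (hS : IsExpansion S) :
    IsExpansion (fun p q => f (S p q)) := by
  obtain ⟨⟨Y, hY⟩, hX⟩ := hS
  refine ⟨⟨Y, fun p q h => by simp [hY p q h]⟩, fun q => ?_⟩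
  obtain ⟨X, hX⟩ := hX q
  exact ⟨X, fun p h => by simp [hX p h]⟩

lemma IsExpansion.sub {S T : ℤ → ℤ → E} (hS : IsExpansion S) (hT : IsExpansion T) :
    IsExpansion (S - T) := by
  have := hS.add (hT.map (-AddMonoidHom.id E))
  rwa [show S + (fun p q => (-AddMonoidHom.id E) (T p q)) = S - T by ext; simp [sub_eq_add_neg]]
    at this

lemma IsExpansion.shift {S : ℤ → ℤ → E} (hS : IsExpansion S) (a b : ℤ) :
    IsExpansion (fun p q => S (p - a) (q - b)) := by
  obtain ⟨⟨Y, hY⟩, hX⟩ := hS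
  refine ⟨⟨Y + b, fun p q h => hY _ _ (by omega)⟩, fun q => ?_⟩
  obtain ⟨X, hX⟩ := hX (q - b)
  exact ⟨X + a, fun p h => hX _ (by omega)⟩

lemma IsExpansion.mulDiff {S : ℤ → ℤ → E} (hS : IsExpansion S) : IsExpansion (mulDiff S) := by
  have := (hS.shift 0 1).sub (hS.shift 1 0)
  convert this using 1
  ext p q
  simp [SpinCS.mulDiff]

/-- A doubly bounded series is an expansion. -/
lemma IsExpansion.of_bounded {S : ℤ → ℤ → E} {X Y : ℤ} (hX : ∀ p q, X < p → S p q = 0)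
    (hY : ∀ p q, Y < q → S p q = 0) : IsExpansion S :=
  ⟨⟨Y, hY⟩, fun q => ⟨X, fun p h => hX p q h⟩⟩

/-- A series killed by `y - x` is constant along each antidiagonal `p + q = const`; following the
antidiagonal to large `q` leaves the support of an expansion. -/
lemma IsExpansion.eq_zero_of_mulDiff {S : ℤ → ℤ → E} (hS : IsExpansion S)
    (h : SpinCS.mulDiff S = 0) : S = 0 := by
  obtain ⟨⟨Y, hY⟩, -⟩ := hS
  have key : ∀ (i : ℕ) p q, S p q = S (p - i) (q + i) := by
    intro i
    induction i with
    | zero => simp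
    | succ i ih =>
      intro p q
      have := congrFun (congrFun h (p - i)) (q + i + 1)
      simp only [SpinCS.mulDiff, Pi.zero_apply, add_sub_cancel_right, sub_eq_zero] at this
      rw [ih, this]
      push_cast
      ring_nf
  ext p q
  rw [key (Y - q + 1).toNat, hY _ _ (by omega)]
  rfl

lemma IsExpansion.eq_zero {S : ℤ → ℤ → E} (hS : IsExpansion S) {M : ℕ}
    (h : SpinCS.mulDiff^[M] S = 0) : S = 0 := by
  induction M generalizing S with
  | zero => exact h
  | succ M ih => exact hS.eq_zero_of_mulDiff (ih hS.mulDiff h)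

lemma IsExpansion.eq_of_iterate {S T : ℤ → ℤ → E} (hS : IsExpansion S) (hT : IsExpansion T)
    {M : ℕ} (h : SpinCS.mulDiff^[M] S = SpinCS.mulDiff^[M] T) : S = T :=
  sub_eq_zero.mp ((hS.sub hT).eq_zero (M := M) (by rw [mulDiff_iterate_sub, h, sub_self]))

/-- Exchanging the variables changes `y - x` only by a sign, so injectivity also holds for
expansions in the opposite region. -/
lemma mulDiff_iterate_swap (M : ℕ) (S : ℤ → ℤ → E) :
    mulDiff^[M] (fun q p => S p q) = fun q p => ((-1 : ℤ) ^ M) • mulDiff^[M] S p q := by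
  induction M generalizing S with
  | zero => simp
  | succ M ih =>
    rw [Function.iterate_succ_apply, show mulDiff (fun q p => S p q) =
      fun q p => (-mulDiff S) p q by ext; simp [mulDiff], ih, Function.iterate_succ_apply]
    ext q p
    rw [← zero_sub (mulDiff S), mulDiff_iterate_sub, mulDiff_iterate_zero, zero_sub, pow_succ]
    simp

lemma IsExpansion.eq_of_iterate_swap {S T : ℤ → ℤ → E} (hS : IsExpansion fun q p => S p q)
    (hT : IsExpansion fun q p => T p q) {M : ℕ}
    (h : SpinCS.mulDiff^[M] S = SpinCS.mulDiff^[M] T) : S = T := by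
  have := hS.eq_of_iterate hT (M := M) (by
    rw [mulDiff_iterate_swap M S, mulDiff_iterate_swap M T, h])
  ext p q
  exact congrFun (congrFun this q) p

/-! ### Analytic continuations and divided differences: uniqueness and linearity. -/

lemma IsContinuation.unique {S C D : ℤ → ℤ → E} (hC : IsContinuation S C)
    (hD : IsContinuation S D) : C = D := by
  obtain ⟨-, h1, M, hM⟩ := hC
  obtain ⟨-, h2, N, hN⟩ := hD
  exact h1.eq_of_iterate_swap h2 (M := max M N)
    ((mulDiff_iterate_congr_of_le (le_max_left _ _) hM.symm).trans
      (mulDiff_iterate_congr_of_le (le_max_right _ _) hN))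

lemma IsContinuation.zero : IsContinuation (0 : ℤ → ℤ → E) 0 :=
  ⟨IsExpansion.zero, IsExpansion.zero, 0, rfl⟩

lemma IsContinuation.add {S S' C C' : ℤ → ℤ → E} (h : IsContinuation S C)
    (h' : IsContinuation S' C') : IsContinuation (S + S') (C + C') := by
  obtain ⟨h1, h2, M, hM⟩ := h
  obtain ⟨h1', h2', M', hM'⟩ := h'
  refine ⟨h1.add h1', h2.add h2', max M M', ?_⟩
  rw [mulDiff_iterate_add, mulDiff_iterate_add,
    mulDiff_iterate_congr_of_le (le_max_left _ _) hM,
    mulDiff_iterate_congr_of_le (le_max_right _ _) hM']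

lemma IsContinuation.map {S C : ℤ → ℤ → E} (f : E →+ E') (h : IsContinuation S C) :
    IsContinuation (fun p q => f (S p q)) (fun p q => f (C p q)) := by
  obtain ⟨h1, h2, M, hM⟩ := h
  exact ⟨h1.map f, h2.map f, M, by rw [mulDiff_iterate_map, mulDiff_iterate_map, hM]⟩

lemma IsContinuation.shift {S C : ℤ → ℤ → E} (h : IsContinuation S C) (a b : ℤ) :
    IsContinuation (fun p q => S (p - a) (q - b)) (fun p q => C (p - a) (q - b)) := by
  obtain ⟨h1, h2, M, hM⟩ := h
  exact ⟨h1.shift a b, h2.shift b a, M, by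
    rw [mulDiff_iterate_shift, mulDiff_iterate_shift, hM]⟩

lemma IsContinuation.sum {ι : Type*} (s : Finset ι) {S C : ι → ℤ → ℤ → E}
    (h : ∀ i ∈ s, IsContinuation (S i) (C i)) :
    IsContinuation (∑ i ∈ s, S i) (∑ i ∈ s, C i) := by
  classical
  induction s using Finset.induction_on with
  | empty => simpa using IsContinuation.zero
  | insert a s ha ih =>
    rw [Finset.sum_insert ha, Finset.sum_insert ha]
    exact (h a (by simp)).add (ih fun i hi => h i (by simp [hi]))

/-- A doubly bounded series is its own continuation. -/
lemma IsContinuation.of_bounded {S : ℤ → ℤ → E} {X Y : ℤ} (hX : ∀ p q, X < p → S p q = 0)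
    (hY : ∀ p q, Y < q → S p q = 0) : IsContinuation S S :=
  ⟨.of_bounded hX hY, .of_bounded (fun q p => hY p q) (fun q p => hX p q), 0, rfl⟩

lemma IsDividedDifference.unique {S S' D D' : ℤ → ℤ → E} (h : IsDividedDifference S S' D)
    (h' : IsDividedDifference S S' D') : D = D' := by
  obtain ⟨-, -, h1, M, hM⟩ := h
  obtain ⟨-, -, h1', N, hN⟩ := h'
  have e1 : mulDiff^[M] (mulDiff D) = mulDiff^[M] (S - S') := hM
  have e2 : mulDiff^[N] (mulDiff D') = mulDiff^[N] (S - S') := hN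
  exact h1.eq_of_iterate h1' (M := max M N + 1)
    ((mulDiff_iterate_congr_of_le (le_max_left _ _) e1).trans
      (mulDiff_iterate_congr_of_le (le_max_right _ _) e2).symm)

/-! ### Contour integrals as finite sums. -/

lemma finsum_eq_sum_range {f : ℕ → E} {B : ℕ} (h : ∀ i, B ≤ i → f i = 0) :
    ∑ᶠ i, f i = ∑ i ∈ Finset.range B, f i :=
  finsum_eq_sum_of_support_subset f fun i hi => by
    by_contra hB
    exact hi (h i (by simpa using hB))

/-- In each region the exponent of the outer variable is bounded above uniformly, so one bound
truncates both sums in `contourIntegral`. -/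
lemma IsContinuation.exists_range {S C : ℤ → ℤ → E} (h : IsContinuation S C) :
    ∃ B : ℕ, ∀ i : ℕ, B ≤ i → (∀ q, C i q = 0) ∧ ∀ p, S p i = 0 := by
  obtain ⟨⟨⟨Y, hY⟩, -⟩, ⟨⟨X, hX⟩, -⟩, -⟩ := h
  exact ⟨(max X Y + 1).toNat, fun i hi =>
    ⟨fun q => hX _ _ (by omega), fun p => hY _ _ (by omega)⟩⟩

lemma IsContinuation.contourIntegral_eq {S C : ℤ → ℤ → E} {B : ℕ}
    (h : ∀ i : ℕ, B ≤ i → (∀ q, C i q = 0) ∧ ∀ p, S p i = 0) :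
    contourIntegral S C = ∑ i ∈ Finset.range B, C i (-1 - i) +
      ∑ i ∈ Finset.range B, S (-1 - i) i := by
  rw [contourIntegral, finsum_eq_sum_range fun i hi => (h i hi).1 _,
    finsum_eq_sum_range fun i hi => (h i hi).2 _]

lemma IsContinuation.contourIntegral_add {S S' C C' : ℤ → ℤ → E} (h : IsContinuation S C)
    (h' : IsContinuation S' C') :
    contourIntegral (S + S') (C + C') = contourIntegral S C + contourIntegral S' C' := by
  obtain ⟨B, hB⟩ := h.exists_range
  obtain ⟨B', hB'⟩ := h'.exists_range
  have h1 : ∀ i : ℕ, max B B' ≤ i → (∀ q, C i q = 0) ∧ ∀ p, S p i = 0 := fun i hi =>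
    hB i ((le_max_left _ _).trans hi)
  have h2 : ∀ i : ℕ, max B B' ≤ i → (∀ q, C' i q = 0) ∧ ∀ p, S' p i = 0 := fun i hi =>
    hB' i ((le_max_right _ _).trans hi)
  rw [IsContinuation.contourIntegral_eq h1, IsContinuation.contourIntegral_eq h2,
    IsContinuation.contourIntegral_eq (B := max B B') fun i hi =>
      ⟨fun q => by simp [(h1 i hi).1, (h2 i hi).1], fun p => by simp [(h1 i hi).2, (h2 i hi).2]⟩]
  simp only [Pi.add_apply, Finset.sum_add_distrib]
  abel

lemma IsContinuation.map_contourIntegral {S C : ℤ → ℤ → E} (f : E →+ E')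
    (h : IsContinuation S C) :
    contourIntegral (fun p q => f (S p q)) (fun p q => f (C p q)) = f (contourIntegral S C) := by
  obtain ⟨B, hB⟩ := h.exists_range
  rw [IsContinuation.contourIntegral_eq hB, IsContinuation.contourIntegral_eq (B := B) fun i hi =>
    ⟨fun q => by simp [(hB i hi).1], fun p => by simp [(hB i hi).2]⟩]
  simp

end Series

section

/-! ### Regular series -/

variable {s : ℕ}

lemma create_inl (c : Fin s) (m : ℕ) : create (Sum.inl (c, m)) = psi c (-1 - m) := by
  rw [show (-1 - m : ℤ) = Int.negSucc m by omega]
  rfl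

lemma create_inr (c : Fin s) (m : ℕ) : create (Sum.inr (c, m)) = psiStar c (-m) := by
  rw [psiStar, neg_neg]
  rfl

lemma psi_psi_apply (a b : Fin s) (n m : ℤ) (v : FockSpace s) :
    psi a n (psi b m v) = -psi b m (psi a n v) :=
  eq_neg_of_add_eq_zero_left (LinearMap.congr_fun (psi_psi a b n m) v)

lemma psiStar_psiStar_apply (a b : Fin s) (n m : ℤ) (v : FockSpace s) :
    psiStar a n (psiStar b m v) = -psiStar b m (psiStar a n v) :=
  eq_neg_of_add_eq_zero_left (LinearMap.congr_fun (psiStar_psiStar a b n m) v)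

lemma psi_psiStar_apply (a b : Fin s) (n m : ℤ) (v : FockSpace s) :
    psi a n (psiStar b m v) = -psiStar b m (psi a n v) + if a = b ∧ n = -m then v else 0 := by
  have := LinearMap.congr_fun (psi_psiStar a b n m) v
  rw [LinearMap.add_apply, Module.End.mul_apply, Module.End.mul_apply] at this
  rw [eq_neg_add_iff_add_eq, add_comm, this]
  split_ifs <;> rfl

lemma psiStar_psi_apply (a b : Fin s) (n m : ℤ) (v : FockSpace s) :
    psiStar a n (psi b m v) = -psi b m (psiStar a n v) + if a = b ∧ m = -n then v else 0 := by
  rw [psi_psiStar_apply, neg_add, neg_neg, add_assoc]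
  simp [eq_comm]

lemma annihilate_create_apply (g h : (Fin s × ℕ) ⊕ (Fin s × ℕ)) (v : FockSpace s) :
    annihilate g (create h v) = -create h (annihilate g v) + if g = h then v else 0 := by
  have := LinearMap.congr_fun (annihilate_create g h) v
  rw [LinearMap.add_apply, Module.End.mul_apply, Module.End.mul_apply] at this
  rw [eq_neg_add_iff_add_eq, add_comm, this]
  split_ifs <;> rfl

/-- Left multiplication of a series in `z` by `∑_m (m + j choose j) ψ_{c,-m-1} z^{-m-j-1}`, which is
`(-1)^j / j!` times the `j`-th derivative of the creation part `∑_m ψ_{c,-m-1} z^{-m-1}` of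
`Ψ_c(z)`. -/
def etaMul (c : Fin s) (j : ℕ) (φ : ℤ → FockSpace s) : ℤ → FockSpace s := fun q =>
  ∑ᶠ m : ℕ, ((m + j).choose j : ℂ) • create (Sum.inl (c, m)) (φ (q + m + j + 1))

/-- The series in `z` generated from the vacuum by multiplication by `z`, by the creation modes and
by the derivatives of the creation part of the fields `Ψ_c(z)`. -/
inductive RegularSeries : (ℤ → FockSpace s) → Prop
  | vacuum : RegularSeries (Pi.single 0 1)
  | add {φ χ} : RegularSeries φ → RegularSeries χ → RegularSeries (φ + χ)
  | smul (r : ℂ) {φ} : RegularSeries φ → RegularSeries (r • φ)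
  | shift {φ} : RegularSeries φ → RegularSeries (fun q => φ (q - 1))
  | create (g) {φ} : RegularSeries φ → RegularSeries (fun q => create g (φ q))
  | eta (c : Fin s) (j : ℕ) {φ} : RegularSeries φ → RegularSeries (etaMul c j φ)

/-- The truncation `B` is left free, so that several such sums can be compared over a common range.
-/
lemma etaMul_eq_sum {φ : ℤ → FockSpace s} {Q : ℤ} (hQ : ∀ q, Q < q → φ q = 0) (c : Fin s) (j : ℕ)
    {q : ℤ} {B : ℕ} (hB : Q < q + B + j + 1) :
    etaMul c j φ q = ∑ m ∈ Finset.range B,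
      ((m + j).choose j : ℂ) • create (Sum.inl (c, m)) (φ (q + m + j + 1)) :=
  finsum_eq_sum_range fun m hm => by rw [hQ _ (by omega), map_zero, smul_zero]

lemma etaMul_eq_zero {φ : ℤ → FockSpace s} {Q : ℤ} (hQ : ∀ q, Q < q → φ q = 0) (c : Fin s)
    (j : ℕ) {q : ℤ} (hq : Q < q) : etaMul c j φ q = 0 := by
  rw [etaMul_eq_sum hQ c j (B := 0) (by push_cast; omega), Finset.sum_range_zero]

lemma map_etaMul {φ : ℤ → FockSpace s} {Q : ℤ} (hQ : ∀ q, Q < q → φ q = 0) (c : Fin s) (j : ℕ)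
    (f : Module.End ℂ (FockSpace s))
    (hf : ∀ m v, f (create (Sum.inl (c, m)) v) = -create (Sum.inl (c, m)) (f v)) (q : ℤ) :
    f (etaMul c j φ q) = -etaMul c j (fun q => f (φ q)) q := by
  rw [etaMul_eq_sum hQ c j (B := (Q - q + 1).toNat) (by omega), etaMul_eq_sum (Q := Q)
    (fun q hq => by rw [hQ q hq, map_zero]) c j (B := (Q - q + 1).toNat) (by omega), map_sum,
    ← Finset.sum_neg_distrib]
  exact Finset.sum_congr rfl fun m _ => by rw [map_smul, hf, smul_neg]

namespace RegularSeries

variable {φ χ : ℤ → FockSpace s}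

lemma bounded (h : RegularSeries φ) : ∃ Q : ℤ, ∀ q, Q < q → φ q = 0 := by
  induction h with
  | vacuum => exact ⟨0, fun q hq => Pi.single_eq_of_ne hq.ne' _⟩
  | add _ _ h1 h2 =>
    obtain ⟨Q, hQ⟩ := h1
    obtain ⟨R, hR⟩ := h2
    exact ⟨max Q R, fun q hq => by
      rw [Pi.add_apply, hQ q (by omega), hR q (by omega), add_zero]⟩
  | smul r _ h =>
    obtain ⟨Q, hQ⟩ := h
    exact ⟨Q, fun q hq => by rw [Pi.smul_apply, hQ q hq, smul_zero]⟩
  | shift _ h =>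
    obtain ⟨Q, hQ⟩ := h
    exact ⟨Q + 1, fun q hq => hQ _ (by omega)⟩
  | create g _ h =>
    obtain ⟨Q, hQ⟩ := h
    exact ⟨Q, fun q hq => by simp [hQ q hq]⟩
  | eta c j _ h =>
    obtain ⟨Q, hQ⟩ := h
    exact ⟨Q, fun q hq => etaMul_eq_zero hQ c j hq⟩

lemma zero : RegularSeries (0 : ℤ → FockSpace s) := by
  simpa using (vacuum (s := s)).smul 0

lemma neg (h : RegularSeries φ) : RegularSeries (-φ) := by
  simpa using h.smul (-1)

lemma sub (h : RegularSeries φ) (h' : RegularSeries χ) : RegularSeries (φ - χ) := by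
  simpa [sub_eq_add_neg] using h.add h'.neg

lemma sum {ι : Type*} (t : Finset ι) {f : ι → ℤ → FockSpace s}
    (h : ∀ i ∈ t, RegularSeries (f i)) : RegularSeries (∑ i ∈ t, f i) := by
  classical
  induction t using Finset.induction_on with
  | empty => simpa using zero
  | insert a t ha ih =>
    rw [Finset.sum_insert ha]
    exact (h a (by simp)).add (ih fun i hi => h i (by simp [hi]))

lemma shiftNat (h : RegularSeries φ) (n : ℕ) : RegularSeries (fun q => φ (q - n)) := by
  induction n with
  | zero => simpa using h
  | succ n ih => convert ih.shift using 2; push_cast; ring_nf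

/-- Creation modes generate the whole Fock space from the vacuum. -/
lemma const (v : FockSpace s) : RegularSeries (Pi.single 0 v : ℤ → FockSpace s) := by
  have hmap : ∀ (f : Module.End ℂ (FockSpace s)) (v : FockSpace s),
      (Pi.single 0 (f v) : ℤ → FockSpace s) = fun q => f ((Pi.single 0 v : ℤ → FockSpace s) q) :=
    fun f v => funext fun q => (Pi.apply_single (fun _ => f) (fun _ => map_zero f) 0 v q).symm
  induction v using CliffordAlgebra.left_induction with
  | algebraMap r =>
    convert (vacuum (s := s)).smul r using 1
    rw [← Pi.single_smul, Algebra.algebraMap_eq_smul_one]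
  | add x y hx hy => rw [Pi.single_add]; exact hx.add hy
  | ι_mul x m hx =>
    have : CliffordAlgebra.ι (0 : QuadraticForm ℂ ((Fin s × ℕ) ⊕ (Fin s × ℕ) →₀ ℂ)) m * x =
        ∑ g ∈ m.support, m g • SpinCS.create g x := by
      conv_lhs => rw [← Finsupp.sum_single m, Finsupp.sum, map_sum, Finset.sum_mul]
      refine Finset.sum_congr rfl fun g _ => ?_
      rw [← Finsupp.smul_single_one, map_smul, smul_mul_assoc]
      rfl
    rw [this, show (Pi.single 0 (∑ g ∈ m.support, m g • SpinCS.create g x) : ℤ → FockSpace s) =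
      ∑ g ∈ m.support, m g • fun q => SpinCS.create g ((Pi.single 0 x : ℤ → FockSpace s) q) by
        simp_rw [← hmap]
        ext1 q
        by_cases hq : q = 0
        · subst hq; simp
        · simp [hq]]
    exact sum _ fun g _ => (hx.create g).smul _

lemma single (n : ℕ) (v : FockSpace s) : RegularSeries (Pi.single (n : ℤ) v) := by
  convert (const v).shiftNat n using 1
  ext1 q
  simp only [Pi.single_apply, sub_eq_zero]

/-- The part of a regular series with negative exponents is regular. -/
lemma truncate (h : RegularSeries φ) : RegularSeries fun q => if q < 0 then φ q else 0 := by
  obtain ⟨Q, hQ⟩ := h.bounded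
  convert h.sub (sum (Finset.range (Q + 1).toNat) fun n _ => single n (φ n)) using 1
  ext1 q
  simp only [Pi.sub_apply, Finset.sum_apply, Pi.single_apply]
  split_ifs with hq
  · rw [Finset.sum_eq_zero fun n _ => if_neg (by omega), sub_zero]
  · obtain ⟨k, rfl⟩ := Int.eq_ofNat_of_zero_le (not_lt.mp hq)
    simp only [Nat.cast_inj, Finset.sum_ite_eq, Finset.mem_range]
    split_ifs with hk
    · rw [sub_self]
    · rw [hQ _ (by omega), sub_zero]

/-- The derivative of a regular series is regular. -/
lemma deriv (h : RegularSeries φ) : RegularSeries fun q => ((q + 1 : ℤ) : ℂ) • φ (q + 1) := by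
  induction h with
  | vacuum =>
    convert zero (s := s) using 1
    ext1 q
    by_cases hq : q + 1 = 0
    · simp [hq]
    · simp [hq]
  | add _ _ h1 h2 =>
    simp only [Pi.add_apply, smul_add]
    exact h1.add h2
  | smul r _ h =>
    simp only [Pi.smul_apply, smul_comm _ r]
    exact h.smul r
  | @shift φ h' h =>
    -- Leibniz rule: `(z φ)' = z φ' + φ`.
    convert h.shift.add h' using 1
    ext1 q
    simp only [Pi.add_apply, sub_add_cancel, add_sub_cancel_right]
    push_cast
    rw [add_smul, one_smul]
  | create g _ h => simpa only [map_smul] using h.create g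
  | @eta c j φ h' h =>
    -- Writing `η_j` for the series multiplied by in `etaMul c j`, one has `η_j' = -(j + 1)
    -- η_{j+1}`, so `(η_j φ)' = η_j φ' - (j + 1) η_{j+1} φ`.
    convert (h.eta c j).sub ((h'.eta c (j + 1)).smul ((j + 1 : ℕ) : ℂ)) using 1
    obtain ⟨Q, hQ⟩ := h'.bounded
    ext1 q
    simp only [Pi.sub_apply, Pi.smul_apply]
    rw [etaMul_eq_sum hQ c j (B := (Q - q + 1).toNat) (by omega),
      etaMul_eq_sum hQ c (j + 1) (B := (Q - q + 1).toNat) (by push_cast; omega),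
      etaMul_eq_sum (Q := Q) (fun q hq => by rw [hQ _ (by omega), smul_zero]) c j
        (B := (Q - q + 1).toNat) (by omega), Finset.smul_sum, Finset.smul_sum,
      ← Finset.sum_sub_distrib]
    refine Finset.sum_congr rfl fun m _ => ?_
    have hc : ((j + 1 : ℕ) : ℂ) * ((m + (j + 1)).choose (j + 1) : ℕ) =
        (m + j + 1 : ℕ) * ((m + j).choose j : ℕ) := by
      rw [← Nat.cast_mul, ← Nat.cast_mul, ← add_assoc, Nat.add_one_mul_choose_eq, mul_comm]
    have e : q + m + ((j + 1 : ℕ) : ℤ) + 1 = q + m + j + 1 + 1 := by push_cast; ring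
    rw [e, show q + 1 + m + j + 1 = q + m + j + 1 + 1 by ring, map_smul, smul_smul, smul_smul,
      smul_smul, hc, ← sub_smul]
    congr 1
    push_cast
    ring

/-- `z ∂_z` preserves regular series. -/
lemma euler (h : RegularSeries φ) : RegularSeries fun q => (q : ℂ) • φ q := by
  simpa using h.deriv.shift

/-- The modes `ψ_{b,n}` with `n < 0` are creation modes. For `n ≥ 0` the mode contracts only with a
creation mode of `ψ*` type, and it anticommutes with the factors `etaMul`. -/
lemma psi (h : RegularSeries φ) (b : Fin s) (n : ℤ) : RegularSeries fun q => psi b n (φ q) := by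
  rcases n with n | n
  swap
  · exact h.create (Sum.inl (b, n))
  change RegularSeries fun q => annihilate (Sum.inr (b, n)) (φ q)
  induction h with
  | vacuum =>
    convert zero (s := s) using 1
    ext1 q
    have h1 : annihilate (Sum.inr (b, n)) (1 : FockSpace s) = 0 :=
      psi_vacuum b n (Int.natCast_nonneg n)
    by_cases hq : q = 0
    · subst hq; simp [h1]
    · simp [hq]
  | add _ _ h1 h2 =>
    simp only [Pi.add_apply, map_add]
    exact h1.add h2
  | smul r _ h =>
    simp only [Pi.smul_apply, map_smul]
    exact h.smul r
  | shift _ h => exact h.shift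
  | create g h' h =>
    simp only [annihilate_create_apply]
    split_ifs with hg
    · exact (h.create g).neg.add h'
    · simp only [add_zero]
      exact (h.create g).neg
  | eta c j h' h =>
    obtain ⟨Q, hQ⟩ := h'.bounded
    convert (h.eta c j).neg using 1
    ext1 q
    exact map_etaMul hQ c j _ (fun m v => by simp [annihilate_create_apply]) q

lemma etaMul_const (c : Fin s) (v : FockSpace s) (q : ℤ) :
    etaMul c 0 (Pi.single 0 v) q = if q < 0 then SpinCS.psi c q v else 0 := by
  have hQ : ∀ q : ℤ, 0 < q → (Pi.single 0 v : ℤ → FockSpace s) q = 0 :=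
    fun q hq => Pi.single_eq_of_ne hq.ne' _
  split_ifs with hq
  · obtain ⟨k, rfl⟩ := Int.eq_negSucc_of_lt_zero hq
    rw [etaMul_eq_sum hQ c 0 (B := k + 1) (by push_cast; omega), Finset.sum_eq_single k]
    · rw [Int.negSucc_eq, Nat.cast_zero, show -((k : ℤ) + 1) + k + 0 + 1 = 0 by ring, Pi.single_eq_same,
        create_inl, show (-1 - k : ℤ) = -((k : ℤ) + 1) by ring]
      simp
    · intro m _ hm
      rw [Pi.single_eq_of_ne (by rw [Int.negSucc_eq]; push_cast; omega), map_zero, smul_zero]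
    · simp
  · rw [etaMul_eq_sum hQ c 0 (B := 0) (by push_cast; omega), Finset.sum_range_zero]

/-- The series `Ψ_c(z) |v⟩` is regular. -/
lemma field (c : Fin s) (v : FockSpace s) : RegularSeries fun q => SpinCS.psi c q v := by
  obtain ⟨K, hK⟩ := exists_psi_eq_zero v
  -- The creation part of the field, plus finitely many nonnegative powers of `z`.
  convert ((const v).eta c 0).add
    (sum (Finset.range (K + 1).toNat) fun n _ => single n (SpinCS.psi c n v)) using 1
  ext1 q
  rw [Pi.add_apply, etaMul_const]
  simp only [Finset.sum_apply, Pi.single_apply]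
  split_ifs with hq
  · rw [Finset.sum_eq_zero fun n _ => if_neg (by omega), add_zero]
  · obtain ⟨k, rfl⟩ := Int.eq_ofNat_of_zero_le (not_lt.mp hq)
    simp only [Nat.cast_inj, Finset.sum_ite_eq, Finset.mem_range, zero_add]
    split_ifs with hk
    · rfl
    · exact hK _ _ (by omega)

/-- The product `Ψ_b(w) φ(z)` is bounded in `w`, so that it has no pole at `w = z`. -/
lemma psi_bounded (h : RegularSeries φ) (b : Fin s) :
    ∃ P : ℤ, ∀ p, P < p → ∀ q, SpinCS.psi b p (φ q) = 0 := by
  induction h with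
  | vacuum =>
    refine ⟨0, fun p hp q => ?_⟩
    by_cases hq : q = 0
    · subst hq; simp [psi_vacuum b p hp.le]
    · simp [hq]
  | add _ _ h1 h2 =>
    obtain ⟨P, hP⟩ := h1
    obtain ⟨R, hR⟩ := h2
    exact ⟨max P R, fun p hp q => by
      rw [Pi.add_apply, map_add, hP p (by omega), hR p (by omega), add_zero]⟩
  | smul r _ h =>
    obtain ⟨P, hP⟩ := h
    exact ⟨P, fun p hp q => by rw [Pi.smul_apply, map_smul, hP p hp, smul_zero]⟩
  | shift _ h =>
    obtain ⟨P, hP⟩ := h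
    exact ⟨P, fun p hp q => hP p hp _⟩
  | create g _ h =>
    obtain ⟨P, hP⟩ := h
    rcases g with ⟨c, k⟩ | ⟨c, k⟩
    · exact ⟨P, fun p hp q => by rw [create_inl, psi_psi_apply, hP p hp, map_zero, neg_zero]⟩
    -- The contraction with `ψ*_{c,-k}` occurs only at `p = k`, so it is enough to raise the bound
    -- to `k`.
    · exact ⟨max P k, fun p hp q => by
        rw [create_inr, psi_psiStar_apply, hP p (by omega), map_zero, neg_zero, zero_add,
          if_neg (by omega)]⟩
  | eta c j h' h =>
    obtain ⟨P, hP⟩ := h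
    obtain ⟨Q, hQ⟩ := h'.bounded
    refine ⟨P, fun p hp q => ?_⟩
    rw [map_etaMul hQ c j _ (fun m v => by rw [create_inl, psi_psi_apply]), etaMul]
    simp [hP p hp]

end RegularSeries

end

section

/-! ### Polar parts and continuations -/

variable {s : ℕ}

lemma etaMul_add {φ χ : ℤ → FockSpace s} (hφ : ∃ Q : ℤ, ∀ q, Q < q → φ q = 0)
    (hχ : ∃ Q : ℤ, ∀ q, Q < q → χ q = 0) (c : Fin s) (j : ℕ) :
    etaMul c j (φ + χ) = etaMul c j φ + etaMul c j χ := by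
  obtain ⟨Q, hQ⟩ := hφ
  obtain ⟨R, hR⟩ := hχ
  have hQ' : ∀ q, max Q R < q → φ q = 0 := fun q hq => hQ q (by omega)
  have hR' : ∀ q, max Q R < q → χ q = 0 := fun q hq => hR q (by omega)
  ext1 q
  have hB : max Q R < q + (max Q R - q + 1).toNat + j + 1 := by omega
  rw [Pi.add_apply, etaMul_eq_sum hQ' c j hB, etaMul_eq_sum hR' c j hB,
    etaMul_eq_sum (fun q hq => by rw [Pi.add_apply, hQ' q hq, hR' q hq, add_zero]) c j hB,
    ← Finset.sum_add_distrib]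
  simp only [Pi.add_apply, map_add, smul_add]

lemma etaMul_smul (φ : ℤ → FockSpace s) (c : Fin s) (j : ℕ) (r : ℂ) :
    etaMul c j (r • φ) = r • etaMul c j φ := by
  ext1 q
  simp only [etaMul, Pi.smul_apply, map_smul, smul_finsum, smul_comm r]

lemma etaMul_zero (c : Fin s) (j : ℕ) : etaMul c j (0 : ℤ → FockSpace s) = 0 := by
  ext1 q
  simp [etaMul]

lemma etaMul_sum {ι : Type*} (t : Finset ι) {f : ι → ℤ → FockSpace s}
    (hf : ∀ i ∈ t, ∃ Q : ℤ, ∀ q, Q < q → f i q = 0) (c : Fin s) (j : ℕ) :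
    etaMul c j (∑ i ∈ t, f i) = ∑ i ∈ t, etaMul c j (f i) := by
  classical
  induction t using Finset.induction_on with
  | empty => exact etaMul_zero c j
  | insert a t ha ih =>
    have ht : ∀ i ∈ t, ∃ Q : ℤ, ∀ q, Q < q → f i q = 0 := fun i hi => hf i (by simp [hi])
    rw [Finset.sum_insert ha, Finset.sum_insert ha, ← ih ht, etaMul_add (hf a (by simp))]
    choose! Q hQ using ht
    obtain ⟨M, hM⟩ := (t.image Q).exists_le
    refine ⟨M, fun q hq => ?_⟩
    rw [Finset.sum_apply]
    exact Finset.sum_eq_zero fun i hi =>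
      hQ i hi q (lt_of_le_of_lt (hM _ (Finset.mem_image_of_mem Q hi)) hq)

lemma etaMul_shift (φ : ℤ → FockSpace s) (c : Fin s) (j : ℕ) (a q : ℤ) :
    etaMul c j (fun q => φ (q + a)) q = etaMul c j φ (q + a) := by
  simp only [etaMul]
  refine finsum_congr fun m => ?_
  ring_nf

/-- The decomposition `∑_{i ≥ 0} u^i ψ*_{b,i+1} φ(z) = ∑_i u^i K_i(z) + ∑_j (z - u)^{-j-1} L_j(z)`
of the annihilation part of `Ψ*_b(u) φ(z)` into a polynomial in `u` and a polar part at `u = z`. -/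
structure IsPolarDecomposition (b : Fin s) (φ : ℤ → FockSpace s) (K L : ℕ →₀ ℤ → FockSpace s) :
    Prop where
  regularSeries_left : ∀ i, RegularSeries (K i)
  regularSeries_right : ∀ j, RegularSeries (L j)
  psiStar_eq : ∀ (i : ℕ) (q : ℤ), psiStar b (i + 1) (φ q) = K i q +
    L.sum fun j l => ((i + j).choose j : ℂ) • l (q + i + j + 1)

/-- The annihilation modes of `Ψ*_b` are moved to the vacuum past each generator. A creation mode
`ψ_{b,-k-1}` contributes to the coefficient of `u^k`. A factor `etaMul b j` contributes a pole of
order `j + 1`, through `(z - u)^{-j-1} = ∑_i (i + j choose j) u^i z^{-i-j-1}`. -/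
lemma RegularSeries.exists_polarDecomposition {φ : ℤ → FockSpace s} (h : RegularSeries φ)
    (b : Fin s) : ∃ K L, IsPolarDecomposition b φ K L := by
  induction h with
  | vacuum =>
    refine ⟨0, 0, fun _ => .zero, fun _ => .zero, fun i q => ?_⟩
    by_cases hq : q = 0
    · subst hq; simp [psiStar_vacuum b (i + 1) (by omega)]
    · simp [hq]
  | add _ _ h1 h2 =>
    obtain ⟨K, L, hK, hL, h1⟩ := h1
    obtain ⟨K', L', hK', hL', h2⟩ := h2
    refine ⟨K + K', L + L', fun i => (hK i).add (hK' i), fun i => (hL i).add (hL' i),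
      fun i q => ?_⟩
    rw [Finsupp.sum_add_index' (by simp) (by simp [smul_add]), Pi.add_apply, map_add, h1, h2,
      Finsupp.add_apply, Pi.add_apply]
    abel
  | smul r _ h =>
    obtain ⟨K, L, hK, hL, h⟩ := h
    refine ⟨r • K, r • L, fun i => (hK i).smul r, fun i => (hL i).smul r, fun i q => ?_⟩
    rw [Finsupp.sum_smul_index' (by simp), Pi.smul_apply, map_smul, h, Finsupp.smul_apply,
      Pi.smul_apply, smul_add, Finsupp.smul_sum]
    simp only [Pi.smul_apply, smul_comm r]
  | shift _ h =>
    obtain ⟨K, L, hK, hL, h⟩ := h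
    refine ⟨K.mapRange (fun (φ : ℤ → FockSpace s) (q : ℤ) => φ (q - 1)) rfl,
      L.mapRange (fun (φ : ℤ → FockSpace s) (q : ℤ) => φ (q - 1)) rfl, fun i => (hK i).shift, fun i => (hL i).shift, fun i q => ?_⟩
    rw [Finsupp.sum_mapRange_index (by simp), h, Finsupp.mapRange_apply]
    congr 1
    refine Finsupp.sum_congr fun j _ => ?_
    ring_nf
  | @create g φ h' h =>
    obtain ⟨K, L, hK, hL, h⟩ := h
    have h0 : (fun (φ : ℤ → FockSpace s) q => -SpinCS.create g (φ q)) 0 = 0 := by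
      ext1 q; simp
    have key : ∃ t : ℕ →₀ ℤ → FockSpace s, (∀ i, RegularSeries (t i)) ∧ ∀ (i : ℕ) q,
        psiStar b (i + 1) (SpinCS.create g (φ q)) = -SpinCS.create g (psiStar b (i + 1) (φ q)) + t i q := by
      rcases g with ⟨c, k⟩ | ⟨c, k⟩
      · by_cases hbc : b = c
        · refine ⟨Finsupp.single k φ, fun i => ?_, fun i q => ?_⟩
          · rw [Finsupp.single_apply]
            split_ifs
            exacts [h', .zero]
          · rw [create_inl, psiStar_psi_apply, Finsupp.single_apply]
            by_cases hk : k = i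
            · rw [if_pos ⟨hbc, by omega⟩, if_pos hk]
            · rw [if_neg (by omega), if_neg hk]
              rfl
        · refine ⟨0, fun i => .zero, fun i q => ?_⟩
          rw [create_inl, psiStar_psi_apply, if_neg (by tauto)]
          rfl
      · refine ⟨0, fun i => .zero, fun i q => ?_⟩
        rw [create_inr, psiStar_psiStar_apply]
        simp
    obtain ⟨t, ht, key⟩ := key
    refine ⟨K.mapRange (fun (φ : ℤ → FockSpace s) q => -SpinCS.create g (φ q)) h0 + t,
      L.mapRange (fun (φ : ℤ → FockSpace s) q => -SpinCS.create g (φ q)) h0, fun i => ((hK i).create g).neg.add (ht i),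
      fun i => ((hL i).create g).neg, fun i q => ?_⟩
    rw [Finsupp.sum_mapRange_index (by simp), key, h, map_add, Finsupp.add_apply, Pi.add_apply,
      Finsupp.mapRange_apply, Finsupp.sum, map_sum, Finsupp.sum]
    simp only [map_smul, smul_neg, Finset.sum_neg_distrib]
    abel
  | @eta c j φ h' h =>
    obtain ⟨K, L, hK, hL, h⟩ := h
    have h0 : (fun (φ : ℤ → FockSpace s) => -etaMul c j φ) 0 = 0 := by simp [etaMul_zero]
    refine ⟨K.mapRange (fun (φ : ℤ → FockSpace s) => -etaMul c j φ) h0,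
      L.mapRange (fun (φ : ℤ → FockSpace s) => -etaMul c j φ) h0 + if b = c then Finsupp.single j φ else 0,
      fun i => ((hK i).eta c j).neg, fun i => ?_, fun i q => ?_⟩
    · rw [Finsupp.add_apply]
      refine ((hL i).eta c j).neg.add ?_
      split_ifs
      · rw [Finsupp.single_apply]
        split_ifs
        exacts [h', .zero]
      · exact .zero
    -- The mode `ψ*_{b,i+1}` contracts only with the term `m = i` of `etaMul`.
    · have e1 : psiStar b (i + 1) (etaMul c j φ q) =
          -etaMul c j (fun q => psiStar b (i + 1) (φ q)) q +
          if b = c then ((i + j).choose j : ℂ) • φ (q + i + j + 1) else 0 := by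
        obtain ⟨Q, hQ⟩ := h'.bounded
        have hB : Q < q + ((Q - q + 1).toNat + i + 1 : ℕ) + j + 1 := by push_cast; omega
        rw [etaMul_eq_sum hQ c j hB, etaMul_eq_sum (fun q hq => by rw [hQ q hq, map_zero]) c j hB,
          map_sum, ← Finset.sum_neg_distrib]
        simp only [create_inl, map_smul, psiStar_psi_apply, smul_add, Finset.sum_add_distrib,
          smul_neg]
        congr 1
        rw [Finset.sum_eq_single_of_mem i (by simp) fun m _ hm => by
          rw [if_neg (by omega), smul_zero]]
        by_cases hbc : b = c
        · rw [if_pos ⟨hbc, by omega⟩, if_pos hbc]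
        · rw [if_neg (by tauto), if_neg hbc, smul_zero]
      -- The polar part is a combination of shifts of the `L j`, and `etaMul` commutes with shifts.
      have e2 : (fun q => psiStar b (i + 1) (φ q)) = K i + ∑ j ∈ L.support,
          ((i + j).choose j : ℂ) • fun q => L j (q + (i + j + 1)) := by
        ext1 q
        rw [h, Pi.add_apply, Finsupp.sum]
        simp only [Finset.sum_apply, Pi.smul_apply, ← add_assoc]
      have hb : ∀ j, ∃ Q : ℤ, ∀ q, Q < q →
          (((i + j).choose j : ℂ) • fun q => L j (q + (i + j + 1))) q = 0 := fun j => by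
        obtain ⟨Q, hQ⟩ := (hL j).bounded
        exact ⟨Q, fun q hq => by rw [Pi.smul_apply, hQ _ (by omega), smul_zero]⟩
      have hb' : ∃ Q : ℤ, ∀ q, Q < q → (∑ j ∈ L.support,
          ((i + j).choose j : ℂ) • fun q => L j (q + (i + j + 1))) q = 0 := by
        choose Q hQ using hb
        obtain ⟨M, hM⟩ := (L.support.image Q).exists_le
        refine ⟨M, fun q hq => ?_⟩
        rw [Finset.sum_apply]
        exact Finset.sum_eq_zero fun j hj =>
          hQ j q (lt_of_le_of_lt (hM _ (Finset.mem_image_of_mem Q hj)) hq)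
      rw [e1, e2, etaMul_add (hK i).bounded hb', etaMul_sum _ fun j _ => hb j,
        Finsupp.sum_add_index' (by simp) (by simp [smul_add]),
        Finsupp.sum_mapRange_index (by simp), Pi.add_apply, Finset.sum_apply, Finsupp.sum,
        Finsupp.mapRange_apply]
      simp only [etaMul_smul, Pi.smul_apply, etaMul_shift, Pi.neg_apply, smul_neg,
        Finset.sum_neg_distrib]
      simp only [← add_assoc]
      split_ifs
      · rw [Finsupp.sum_single_index (by simp)]
        abel
      · simp only [Finsupp.sum_zero_index]
        abel

/-- The difference of the two expansions of `(y - x)^{-j-1} l(y)`. -/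
def diagonalSeries {E : Type*} [AddCommGroup E] [Module ℂ E] (j : ℕ) (l : ℤ → E) : ℤ → ℤ → E :=
  fun p q => ((Ring.choose (p + j) j : ℤ) : ℂ) • l (q + p + j + 1)

/-- By Pascal's rule one factor `y - x` lowers the order from `j + 1` to `j`; at order `0` the
series depends only on `p + q`. `Ring.choose` makes the binomial coefficient meaningful for negative
`p`, so a single formula covers both expansions. -/
lemma mulDiff_diagonalSeries {E : Type*} [AddCommGroup E] [Module ℂ E] (j : ℕ) (l : ℤ → E) :
    mulDiff^[j + 1] (diagonalSeries j l) = 0 := by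
  induction j with
  | zero =>
    ext p q
    simp only [zero_add, Function.iterate_one, mulDiff, diagonalSeries, Ring.choose_zero_right]
    rw [show q - 1 + p + ((0 : ℕ) : ℤ) + 1 = q + (p - 1) + ((0 : ℕ) : ℤ) + 1 by ring, sub_self]
    rfl
  | succ j ih =>
    rw [Function.iterate_succ_apply]
    convert ih using 2
    ext p q
    simp only [mulDiff, diagonalSeries]
    rw [show q - 1 + p + ((j + 1 : ℕ) : ℤ) + 1 = q + p + j + 1 by push_cast; ring,
      show q + (p - 1) + ((j + 1 : ℕ) : ℤ) + 1 = q + p + j + 1 by push_cast; ring,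
      ← sub_smul, ← Int.cast_sub, show p + ((j + 1 : ℕ) : ℤ) = p + j + 1 by push_cast; ring,
      show p - 1 + ((j + 1 : ℕ) : ℤ) = p + j by push_cast; ring, Ring.choose_succ_succ,
      add_sub_cancel_right]

/-- The continuation of `Ψ*_b(u) φ(z)` to the region `|z| < |u|`. -/
def psiStarContinuation (b : Fin s) (φ : ℤ → FockSpace s) (K L : ℕ →₀ ℤ → FockSpace s)
    (p q : ℤ) : FockSpace s :=
  if 0 ≤ p then K p.toNat q
  else psiStar b (p + 1) (φ q) - L.sum fun j l => diagonalSeries j l p q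

lemma exists_bound_finsupp {E : Type*} [AddCommGroup E] (L : ℕ →₀ ℤ → E)
    (hL : ∀ j, ∃ Q : ℤ, ∀ q, Q < q → L j q = 0) : ∃ Q : ℤ, ∀ j q, Q < q → L j q = 0 := by
  choose Q hQ using hL
  obtain ⟨M, hM⟩ := (L.support.image Q).exists_le
  refine ⟨M, fun j q hq => ?_⟩
  by_cases hj : j ∈ L.support
  · exact hQ j q (lt_of_le_of_lt (hM _ (Finset.mem_image_of_mem Q hj)) hq)
  · rw [Finsupp.notMem_support_iff.mp hj]; rfl

/-- In the region `|z| < |u|` the functions `(z - u)^{-j-1}` contain only negative powers of `u`. So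
the nonnegative powers retain only `K`, and the two series differ by a sum of diagonal series. -/
lemma IsPolarDecomposition.isContinuation {b : Fin s} {φ : ℤ → FockSpace s}
    {K L : ℕ →₀ ℤ → FockSpace s} (h : IsPolarDecomposition b φ K L) (hφ : RegularSeries φ) :
    IsContinuation (fun p q => psiStar b (p + 1) (φ q)) (psiStarContinuation b φ K L) := by
  obtain ⟨Q, hQ⟩ := hφ.bounded
  obtain ⟨R, hR⟩ := exists_bound_finsupp L fun j => (h.regularSeries_right j).bounded
  obtain ⟨R', hR'⟩ := exists_bound_finsupp K fun j => (h.regularSeries_left j).bounded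
  obtain ⟨I, hI⟩ := K.support.exists_le
  have hI' : ∀ i, I < i → K i = 0 := fun i hi => by
    by_contra h0
    exact absurd (hI i (Finsupp.mem_support_iff.mpr h0)) (by omega)
  refine ⟨⟨⟨Q, fun p q hq => by simp [hQ q hq]⟩, fun q => ⟨max I (R - q), fun p hp => ?_⟩⟩,
    ⟨⟨I, fun q p hp => ?_⟩, fun p => ⟨max (max Q R') (R - p), fun q hq => ?_⟩⟩,
    -- The largest pole order, one more than the largest index in the polar part.
    L.support.sup id + 1, ?_⟩
  · obtain ⟨i, rfl⟩ := Int.eq_ofNat_of_zero_le (show 0 ≤ p by omega)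
    change psiStar b (i + 1) (φ q) = 0
    rw [h.psiStar_eq, hI' i (by omega), Pi.zero_apply, zero_add]
    exact Finset.sum_eq_zero fun j _ => by
      simp only []
      rw [hR j _ (by omega), smul_zero]
  · simp only [psiStarContinuation]
    rw [if_pos (by omega), hI' _ (by omega), Pi.zero_apply]
  · simp only [psiStarContinuation]
    split_ifs with hp
    · exact hR' _ _ (by omega)
    · rw [hQ q (by omega), map_zero, zero_sub, neg_eq_zero]
      exact Finset.sum_eq_zero fun j _ => by
        simp only [diagonalSeries]
        rw [hR j _ (by omega), smul_zero]
  · rw [← sub_eq_zero, ← mulDiff_iterate_sub]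
    have : (fun p q => psiStar b (p + 1) (φ q)) - psiStarContinuation b φ K L =
        ∑ j ∈ L.support, diagonalSeries j (L j) := by
      ext1 p; ext1 q
      simp only [Pi.sub_apply, psiStarContinuation, Finset.sum_apply]
      split_ifs with hp
      · obtain ⟨i, rfl⟩ := Int.eq_ofNat_of_zero_le hp
        rw [h.psiStar_eq, Int.toNat_natCast, add_sub_cancel_left, Finsupp.sum]
        refine Finset.sum_congr rfl fun j _ => ?_
        rw [diagonalSeries, ← Nat.cast_add, Ring.choose_natCast, Int.cast_natCast]
      · rw [sub_sub_cancel, Finsupp.sum]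
    rw [this]
    rw [mulDiff_iterate_sum]
    refine Finset.sum_eq_zero fun j hj => ?_
    rw [mulDiff_iterate_congr_of_le (T := 0) (M := j + 1)
      (Nat.succ_le_succ (Finset.le_sup (f := id) hj)) (by
        rw [mulDiff_diagonalSeries, mulDiff_iterate_zero]), mulDiff_iterate_zero]

lemma RegularSeries.exists_continuation {φ : ℤ → FockSpace s} (hφ : RegularSeries φ) (b : Fin s) :
    ∃ C, IsContinuation (fun p q => psiStar b (p + 1) (φ q)) C := by
  obtain ⟨K, L, h⟩ := hφ.exists_polarDecomposition b
  exact ⟨_, h.isContinuation hφ⟩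

end

section

/-! ### Divided differences -/

variable {s : ℕ}

/-- The antisymmetrization `Ψ_b(w) φ(z) - Ψ_b(z) φ(w)`. -/
def psiCommutator (b : Fin s) (φ : ℤ → FockSpace s) (p q : ℤ) : FockSpace s :=
  psi b p (φ q) - psi b q (φ p)

/-- The divided difference `(Ψ_b(w) φ(z) - Ψ_b(z) φ(w)) / (z - w)`. -/
def psiDividedDifference (b : Fin s) (φ : ℤ → FockSpace s) (p q : ℤ) : FockSpace s :=
  ∑ᶠ i : ℕ, psiCommutator b φ (p - i) (q + 1 + i)

/-- Each of the two terms is bounded in both variables, with the roles of the variables exchanged;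
hence a single bound serves both. -/
lemma RegularSeries.psiCommutator_bounded {φ : ℤ → FockSpace s} (h : RegularSeries φ)
    (b : Fin s) : ∃ X : ℤ, ∀ p q, X < p ∨ X < q → psiCommutator b φ p q = 0 := by
  obtain ⟨P, hP⟩ := h.psi_bounded b
  obtain ⟨Q, hQ⟩ := h.bounded
  refine ⟨max P Q, fun p q hpq => ?_⟩
  rw [psiCommutator]
  rcases hpq with hp | hq
  · rw [hP p (by omega), hQ p (by omega), map_zero, sub_zero]
  · rw [hP q (by omega), hQ q (by omega), map_zero, sub_zero]

lemma psiDividedDifference_eq_sum {b : Fin s} {φ : ℤ → FockSpace s} {X : ℤ}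
    (hX : ∀ p q, X < p ∨ X < q → psiCommutator b φ p q = 0) (p : ℤ) {q : ℤ} {B : ℕ}
    (hB : X < q + 1 + B) : psiDividedDifference b φ p q =
      ∑ i ∈ Finset.range B, psiCommutator b φ (p - i) (q + 1 + i) :=
  finsum_eq_sum_range fun i hi => hX _ _ (Or.inr (by omega))

/-- The two sums telescope along an antidiagonal, leaving the term `i = 0`. -/
lemma mulDiff_psiDividedDifference {b : Fin s} {φ : ℤ → FockSpace s} (h : RegularSeries φ) :
    mulDiff (psiDividedDifference b φ) = psiCommutator b φ := by
  obtain ⟨X, hX⟩ := h.psiCommutator_bounded b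
  ext1 p; ext1 q
  have hB : X < q + (X - q + 1).toNat := by omega
  rw [mulDiff, psiDividedDifference_eq_sum hX p (B := (X - q + 1).toNat + 1) (by push_cast; omega),
    psiDividedDifference_eq_sum hX (p - 1) (B := (X - q + 1).toNat) (by omega),
    Finset.sum_range_succ']
  rw [sub_eq_iff_eq_add, add_comm]
  congr 1
  · simp
  · refine Finset.sum_congr rfl fun i _ => ?_
    congr 1 <;> push_cast <;> ring

/-- The numerator is antisymmetric, so the antisymmetric part of the quotient is killed by `y - x`
and is constant along antidiagonals. Since `(p, q)` and `(q, p)` lie on the same antidiagonal, it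
equals its own negative. This transfers boundedness and regularity from one variable to the other.
-/
lemma psiDividedDifference_symm {b : Fin s} {φ : ℤ → FockSpace s} (h : RegularSeries φ) (p q : ℤ) :
    psiDividedDifference b φ p q = psiDividedDifference b φ q p := by
  set D := psiDividedDifference b φ with hD
  have hm : ∀ p q, D p (q - 1) - D (p - 1) q = psiCommutator b φ p q := fun p q =>
    congrFun (congrFun (mulDiff_psiDividedDifference (b := b) h) p) q
  have hE : ∀ p q, D p q - D q p = D (p - 1) (q + 1) - D (q + 1) (p - 1) := fun p q => by
    have h1 := hm p (q + 1)
    have h2 := hm (q + 1) p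
    rw [add_sub_cancel_right] at h1 h2
    have h3 : psiCommutator b φ p (q + 1) + psiCommutator b φ (q + 1) p = 0 := by
      rw [psiCommutator, psiCommutator]; abel
    rw [← h1, ← h2] at h3
    rw [← sub_eq_zero, ← h3]
    abel
  have key : ∀ (i : ℕ) p q, D p q - D q p = D (p - i) (q + i) - D (q + i) (p - i) := by
    intro i
    induction i with
    | zero => simp
    | succ i ih =>
      intro p q
      rw [ih, hE, show p - i - 1 = p - ((i + 1 : ℕ) : ℤ) by push_cast; ring,
        show q + i + 1 = q + ((i + 1 : ℕ) : ℤ) by push_cast; ring]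
  have key2 : ∀ p q, q ≤ p → D p q = D q p := fun p q hpq => by
    have := key (p - q).toNat p q
    rw [show p - (p - q).toNat = q by omega, show q + (p - q).toNat = p by omega] at this
    have h2 : (2 : ℂ) • (D p q - D q p) = 0 := by
      rw [two_smul]
      nth_rw 2 [this]
      abel
    exact sub_eq_zero.mp ((smul_eq_zero.mp h2).resolve_left two_ne_zero)
  rcases le_total q p with hpq | hpq
  · exact key2 p q hpq
  · exact (key2 q p hpq).symm

lemma psiDividedDifference_bounded {φ : ℤ → FockSpace s} (h : RegularSeries φ) (b : Fin s) :
    ∃ X : ℤ, ∀ p q, X < p ∨ X < q → psiDividedDifference b φ p q = 0 := by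
  obtain ⟨X, hX⟩ := h.psiCommutator_bounded b
  have h1 : ∀ p q, X < q → psiDividedDifference b φ p q = 0 := fun p q hq => by
    rw [psiDividedDifference_eq_sum hX p (B := 0) (by push_cast; omega), Finset.sum_range_zero]
  exact ⟨X, fun p q hpq => hpq.elim (fun hp => by rw [psiDividedDifference_symm h, h1 _ _ hp])
    (h1 p q)⟩

lemma isDividedDifference_psi {φ : ℤ → FockSpace s} (h : RegularSeries φ) (b : Fin s) :
    IsDividedDifference (fun m k => psi b m (φ k)) (fun m k => psi b k (φ m))
      (psiDividedDifference b φ) := by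
  obtain ⟨P, hP⟩ := h.psi_bounded b
  obtain ⟨Q, hQ⟩ := h.bounded
  obtain ⟨X, hX⟩ := psiDividedDifference_bounded h b
  exact ⟨.of_bounded (X := P) (Y := Q) (fun p q hp => hP p hp q) fun p q hq => by simp [hQ q hq],
    .of_bounded (X := P) (Y := Q) (fun p q hp => hP p hp q) fun p q hq => by simp [hQ q hq],
    .of_bounded (X := X) (Y := X) (fun p q hp => hX p q (Or.inl hp))
      fun p q hq => hX p q (Or.inr hq), 0, mulDiff_psiDividedDifference h⟩

lemma RegularSeries.psiCommutator {φ : ℤ → FockSpace s} (h : RegularSeries φ) (b : Fin s) (q : ℤ) :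
    RegularSeries fun p => psiCommutator b φ p q :=
  (RegularSeries.field b (φ q)).sub (h.psi b q)

/-- For a fixed power of `z` only finitely many terms survive, and each is a shifted column of the
commutator. -/
lemma RegularSeries.psiDividedDifference {φ : ℤ → FockSpace s} (h : RegularSeries φ) (b : Fin s)
    (q : ℤ) : RegularSeries fun p => psiDividedDifference b φ p q := by
  obtain ⟨X, hX⟩ := h.psiCommutator_bounded b
  convert RegularSeries.sum (Finset.range (X - q).toNat) fun i _ =>
    (h.psiCommutator b (q + 1 + i)).shiftNat i using 1
  ext1 p
  rw [psiDividedDifference_eq_sum hX p (B := (X - q).toNat) (by omega), Finset.sum_apply]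

/-! ### The continuation for a divided difference -/

lemma exists_psiStar_eq_zero (b : Fin s) (v : FockSpace s) :
    ∃ K : ℤ, ∀ n, K < n → psiStar b n v = 0 := by
  obtain ⟨C, ⟨-, hX⟩, -⟩ := (RegularSeries.const v).exists_continuation b
  obtain ⟨X, hX⟩ := hX 0
  exact ⟨X + 1, fun n hn => by simpa using hX (n - 1) (by omega)⟩

lemma IsContinuation.sub {E : Type*} [AddCommGroup E] {S S' C C' : ℤ → ℤ → E}
    (h : IsContinuation S C) (h' : IsContinuation S' C') : IsContinuation (S - S') (C - C') := by
  convert h.add (h'.map (-AddMonoidHom.id E)) using 1 <;> ext <;> simp [sub_eq_add_neg]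

/-- The anticommutator of the two fields is the formal delta function, killed by one factor `y - x`:
the pole is simple, and reversing the order with a sign continues the product. -/
lemma isContinuation_psiStar_psi (b : Fin s) (v : FockSpace s) :
    IsContinuation (fun p q => psiStar b (p + 1) (psi b q v))
      (fun p q => -psi b q (psiStar b (p + 1) v)) := by
  obtain ⟨C, hC⟩ := (RegularSeries.field b v).exists_continuation b
  obtain ⟨K, hK⟩ := exists_psiStar_eq_zero b v
  refine ⟨hC.1, ⟨⟨K, fun q p hp => ?_⟩, fun p => ?_⟩, 1, ?_⟩
  · simp [hK (p + 1) (by omega)]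
  · obtain ⟨N, hN⟩ := exists_psi_eq_zero (psiStar b (p + 1) v)
    exact ⟨N, fun q hq => by simp [hN b q hq]⟩
  · rw [← sub_eq_zero, ← mulDiff_iterate_sub, ← mulDiff_diagonalSeries 0 (Pi.single 0 v)]
    congr 1
    ext1 p; ext1 q
    simp only [Pi.sub_apply, psiStar_psi_apply, diagonalSeries, Ring.choose_zero_right,
      true_and]
    by_cases hq : q = -(p + 1)
    · rw [if_pos hq, show q + p + ((0 : ℕ) : ℤ) + 1 = 0 by push_cast; omega]
      simp
    · rw [if_neg hq, Pi.single_eq_of_ne (by push_cast; omega)]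
      simp

/-- For a single mode `ψ_{b,m}` the contraction with `Ψ*_b(u)` is one power of `u` times `φ`, a
bounded series that continues to itself. -/
lemma isContinuation_psiStar_psi_comp {b : Fin s} {φ : ℤ → FockSpace s} {C : ℤ → ℤ → FockSpace s}
    (hφ : RegularSeries φ) (hC : IsContinuation (fun p q => psiStar b (p + 1) (φ q)) C) (m : ℤ) :
    IsContinuation (fun p q => psiStar b (p + 1) (psi b m (φ q)))
      (fun p q => -psi b m (C p q) + if m = -(p + 1) then φ q else 0) := by
  obtain ⟨Q, hQ⟩ := hφ.bounded
  have h1 := hC.map (-(psi b m)).toAddMonoidHom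
  have h2 : IsContinuation (fun p q => if m = -(p + 1) then φ q else 0)
      (fun p q => if m = -(p + 1) then φ q else 0) :=
    .of_bounded (X := -m - 1) (Y := Q) (fun p q hp => if_neg (by omega)) fun p q hq => by
      simp [hQ q hq]
  convert h1.add h2 using 1
  · ext1 p; ext1 q
    simp [psiStar_psi_apply]
  · ext1 p; ext1 q
    simp

/-- The continuation of `Ψ*_b(u) Δ(w)`, where `Δ` is a coefficient of a divided difference. -/
lemma isContinuation_psiStar_psiDividedDifference {b : Fin s} {φ : ℤ → FockSpace s}
    {C : ℤ → ℤ → FockSpace s} (hφ : RegularSeries φ)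
    (hC : IsContinuation (fun p q => psiStar b (p + 1) (φ q)) C) {X : ℤ}
    (hX : ∀ p q, X < p ∨ X < q → psiCommutator b φ p q = 0) (k : ℤ) {B : ℕ} (hB : X < k + 1 + B) :
    IsContinuation (fun p q => psiStar b (p + 1) (psiDividedDifference b φ q k))
      (fun p q => ∑ i ∈ Finset.range B, (-psi b (q - i) (psiStar b (p + 1) (φ (k + 1 + i))) -
        (-psi b (k + 1 + i) (C p (q - i)) + if k + 1 + i = -(p + 1) then φ (q - i) else 0))) := by
  have h := IsContinuation.sum (Finset.range B) fun i _ =>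
    ((isContinuation_psiStar_psi b (φ (k + 1 + i))).sub
      (isContinuation_psiStar_psi_comp hφ hC (k + 1 + i))).shift 0 i
  convert h using 1
  · ext1 p; ext1 q
    rw [psiDividedDifference_eq_sum hX q hB]
    simp [psiCommutator, Finset.sum_apply]
  · ext1 p; ext1 q
    simp [Finset.sum_apply]

lemma sum_range_range_eq_antidiagonal {E : Type*} [AddCommMonoid E] (n : ℕ) (f : ℕ → ℕ → E)
    (h : ∀ p i, n ≤ p + i → f p i = 0) : ∑ p ∈ Finset.range n, ∑ i ∈ Finset.range n, f p i =
      ∑ m ∈ Finset.range n, ∑ p ∈ Finset.range (m + 1), f p (m - p) := by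
  rw [Finset.sum_range_diag_flip]
  refine Finset.sum_congr rfl fun p _ => (Finset.sum_subset ?_ fun i _ hi => ?_).symm
  · exact Finset.range_subset_range.mpr (Nat.sub_le _ _)
  · exact h p i (by rw [Finset.mem_range] at hi; omega)

/-- The hockey-stick identity `∑_{p ≤ m} (p + j choose j) = (m + j + 1 choose j + 1)`. Integration
thus raises the order of differentiation by one, which is why derivatives of all orders are
generators of the class. -/
lemma sum_psi_eq_etaMul (b : Fin s) (j : ℕ) {l : ℤ → FockSpace s} {Q : ℤ}
    (hQ : ∀ q, Q < q → l q = 0) (k : ℤ) {n : ℕ} (hn : Q < k + n) :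
    ∑ p ∈ Finset.range n, ∑ i ∈ Finset.range n,
      ((p + j).choose j : ℂ) • psi b (-1 - p - i) (l (k + 1 + i + p + j + 1)) =
      etaMul b (j + 1) l k := by
  rw [sum_range_range_eq_antidiagonal n _ fun p i hpi => by
    rw [hQ _ (by omega), map_zero, smul_zero], etaMul_eq_sum hQ b (j + 1) (B := n) (by
      push_cast; omega)]
  refine Finset.sum_congr rfl fun m _ => ?_
  rw [← add_assoc, ← Nat.sum_range_add_choose m j, Nat.cast_sum, Finset.sum_smul]
  refine Finset.sum_congr rfl fun p hp => ?_
  rw [Finset.mem_range] at hp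
  rw [create_inl, show (-1 - p - ((m - p : ℕ) : ℤ) : ℤ) = -1 - m by omega,
    show k + 1 + ((m - p : ℕ) : ℤ) + p + j + 1 = k + m + ((j + 1 : ℕ) : ℤ) + 1 by
      push_cast; omega]

/-- The condition forces `p + i = -k - 2`, which has `-(k + 1)` solutions when `k + 1 < 0`; this
count is the factor produced by a derivative. -/
lemma sum_ite_eq_deriv {φ : ℤ → FockSpace s} (k : ℤ) {n : ℕ} (hn : -k < n) :
    ∑ p ∈ Finset.range n, ∑ i ∈ Finset.range n,
      (if k + 1 + i = -(p + 1 : ℤ) then φ (-1 - p - i) else 0) =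
      -(((k + 1 : ℤ) : ℂ) • if k + 1 < 0 then φ (k + 1) else 0) := by
  rw [sum_range_range_eq_antidiagonal n _ fun p i hpi => if_neg (by omega)]
  have h1 : ∀ m ∈ Finset.range n, ∑ p ∈ Finset.range (m + 1),
      (if k + 1 + ((m - p : ℕ) : ℤ) = -(p + 1 : ℤ) then φ (-1 - p - ((m - p : ℕ) : ℤ)) else 0) =
      if k + 1 < 0 ∧ m = (-(k + 2)).toNat then (-((k + 1 : ℤ) : ℂ)) • φ (k + 1) else 0 := by
    intro m _
    rw [Finset.sum_congr rfl fun p hp => show _ = if k + 1 = -(m + 1 : ℤ) then φ (k + 1) else 0 by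
      rw [Finset.mem_range] at hp
      by_cases h : k + 1 = -(m + 1 : ℤ)
      · rw [if_pos h, if_pos (by omega)]
        congr 1
        omega
      · rw [if_neg h, if_neg (by omega)]]
    rw [Finset.sum_const, Finset.card_range]
    by_cases h : k + 1 = -(m + 1 : ℤ)
    · rw [if_pos h, if_pos (by omega), h, ← Nat.cast_smul_eq_nsmul ℂ]
      push_cast
      ring_nf
    · rw [if_neg h, if_neg (by omega), smul_zero]
  rw [Finset.sum_congr rfl h1]
  by_cases hk : k + 1 < 0
  · simp only [hk, true_and, Finset.sum_ite_eq', Finset.mem_range, if_true]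
    rw [if_pos (by omega), neg_smul]
  · simp [hk]

/-- The contour integral of `Ψ*_b(u) (Ψ_b(w) φ(z) - Ψ_b(z) φ(w)) / ((u - w) (z - w))` is a regular
series in `z`. -/
lemma RegularSeries.contourIntegral {φ : ℤ → FockSpace s} (hφ : RegularSeries φ) (b : Fin s)
    {C : ℤ → ℤ → ℤ → FockSpace s}
    (hC : ∀ k, IsContinuation
      (fun p q => psiStar b (p + 1) (SpinCS.psiDividedDifference b φ q k)) (C k)) :
    RegularSeries fun k => SpinCS.contourIntegral
      (fun p q => psiStar b (p + 1) (SpinCS.psiDividedDifference b φ q k)) (C k) := by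
  obtain ⟨K, L, hKL⟩ := hφ.exists_polarDecomposition b
  have hcont := hKL.isContinuation hφ
  obtain ⟨X, hX⟩ := hφ.psiCommutator_bounded b
  obtain ⟨Y, hY⟩ := psiDividedDifference_bounded hφ b
  obtain ⟨R, hR⟩ := exists_bound_finsupp L fun j => (hKL.regularSeries_right j).bounded
  have hKX : ∀ i, ∃ Z : ℤ, ∀ p q, Z < p ∨ Z < q → SpinCS.psiCommutator b (K i) p q = 0 :=
    fun i => (hKL.regularSeries_left i).psiCommutator_bounded b
  choose Z hZ using hKX
  obtain ⟨Z', hZ'⟩ := (K.support.image Z).exists_le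
  obtain ⟨I, hI⟩ := K.support.exists_le
  -- The value of the integral. The contour `|u| > |w|` gives divided differences of the `K i`, the
  -- terms `etaMul b (j + 1) (L j)` from the poles, and a derivative from the contractions of `Ψ*_b`
  -- with the outer mode; the contour `|u| < |w|` gives the last sum.
  have hreg : RegularSeries ((-∑ i ∈ K.support,
      (fun k => SpinCS.psiDividedDifference b (K i) (-1 - i) k)) -
      ∑ j ∈ L.support, etaMul b (j + 1) (L j) +
      (fun k => ((k + 1 : ℤ) : ℂ) • if k + 1 < 0 then φ (k + 1) else 0) +
      ∑ i ∈ Finset.range (Y + 1).toNat,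
        fun k => SpinCS.create (Sum.inr (b, i)) (SpinCS.psiDividedDifference b φ i k)) := by
    refine (((RegularSeries.sum _ fun i _ => ?_).neg.sub (RegularSeries.sum _ fun j _ =>
      (hKL.regularSeries_right j).eta b (j + 1))).add hφ.truncate.deriv).add
      (RegularSeries.sum _ fun i _ => ?_)
    · simp only [psiDividedDifference_symm (hKL.regularSeries_left i) (-1 - i)]
      exact (hKL.regularSeries_left i).psiDividedDifference b _
    · simp only [psiDividedDifference_symm hφ (i : ℤ)]
      exact (hφ.psiDividedDifference b _).create _
  convert hreg using 1
  ext1 k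
  obtain ⟨B, hB⟩ := (hC k).exists_range
  obtain ⟨n, hn⟩ : ∃ n : ℕ, B ≤ n ∧ X < k + n ∧ R < k + n ∧ -k < n ∧ Z' < k + n ∧ Y < n ∧ I < n :=
    ⟨B + (X - k + 1).toNat + (R - k + 1).toNat + (-k + 1).toNat + (Z' - k + 1).toNat +
      (Y + 1).toNat + I + 1, by omega⟩
  have hCk := (hC k).unique (isContinuation_psiStar_psiDividedDifference hφ hcont hX k (B := n)
    (by omega))
  rw [IsContinuation.contourIntegral_eq (B := n) fun i hi => hB i (hn.1.trans hi)]
  simp only [Pi.add_apply, Pi.sub_apply, Pi.neg_apply, Finset.sum_apply]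
  congr 1
  · rw [hCk]
    -- For `p ≥ 0` the continuation of `Ψ*_b φ` is `K p`, while `ψ*_{b,p+1} φ` is `K p` plus the
    -- polar part. The `K p` therefore combine into a commutator, and the poles enter only once.
    have hterm : ∀ p ∈ Finset.range n, ∀ i ∈ Finset.range n,
        -SpinCS.psi b (-1 - p - i) (psiStar b (p + 1) (φ (k + 1 + i))) -
          (-SpinCS.psi b (k + 1 + i) (psiStarContinuation b φ K L p (-1 - p - i)) +
            if k + 1 + i = -(p + 1 : ℤ) then φ (-1 - p - i) else 0) =
        -SpinCS.psiCommutator b (K p) (-1 - p - i) (k + 1 + i) -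
          (∑ j ∈ L.support, ((p + j).choose j : ℂ) •
            SpinCS.psi b (-1 - p - i) (L j (k + 1 + i + p + j + 1))) -
          if k + 1 + i = -(p + 1 : ℤ) then φ (-1 - p - i) else 0 := by
      intro p _ i _
      rw [hKL.psiStar_eq, psiStarContinuation, if_pos (by omega), Int.toNat_natCast,
        SpinCS.psiCommutator, map_add, Finsupp.sum, map_sum]
      simp only [map_smul]
      abel
    rw [Finset.sum_congr rfl fun p hp => Finset.sum_congr rfl (hterm p hp)]
    simp only [Finset.sum_sub_distrib, Finset.sum_neg_distrib]
    rw [sum_ite_eq_deriv k hn.2.2.2.1, sub_neg_eq_add]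
    congr 2
    · rw [neg_inj]
      symm
      refine Finset.sum_subset_zero_on_sdiff (fun i hi => Finset.mem_range.mpr
        ((hI i hi).trans_lt (by omega))) (fun i hi => ?_) fun i hi => ?_
      · rw [Finsupp.notMem_support_iff.mp (Finset.mem_sdiff.mp hi).2]
        exact Finset.sum_eq_zero fun _ _ => by simp [SpinCS.psiCommutator]
      · exact psiDividedDifference_eq_sum (hZ i) _
          (by have := hZ' _ (Finset.mem_image_of_mem Z hi); omega)
    · rw [Finset.sum_congr rfl fun p _ => Finset.sum_comm, Finset.sum_comm]
      exact Finset.sum_congr rfl fun j _ => sum_psi_eq_etaMul b j (hR j) k hn.2.2.1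
  · symm
    refine Finset.sum_subset_zero_on_sdiff (fun i hi => ?_) (fun i hi => ?_) fun i _ => ?_
    · rw [Finset.mem_range] at hi ⊢
      omega
    · rw [Finset.mem_sdiff, Finset.mem_range, Finset.mem_range] at hi
      rw [hY _ _ (Or.inl (by omega)), map_zero]
    · rw [create_inr]
      congr 2
      ring

end

section

/-! ### The operators on the Fock space -/

variable {s : ℕ}

lemma IsDividedDifference.add {E : Type*} [AddCommGroup E] {S S' D T T' D' : ℤ → ℤ → E}
    (h : IsDividedDifference S S' D) (h' : IsDividedDifference T T' D') :
    IsDividedDifference (S + T) (S' + T') (D + D') := by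
  obtain ⟨h1, h2, h3, M, hM⟩ := h
  obtain ⟨h1', h2', h3', M', hM'⟩ := h'
  have e1 : mulDiff^[M] (mulDiff D) = mulDiff^[M] (S - S') := hM
  have e2 : mulDiff^[M'] (mulDiff D') = mulDiff^[M'] (T - T') := hM'
  refine ⟨h1.add h1', h2.add h2', h3.add h3', max M M', ?_⟩
  rw [mulDiff_iterate_add, add_sub_add_comm, mulDiff_iterate_add,
    ← mulDiff_iterate_congr_of_le (le_max_left _ _) e1,
    ← mulDiff_iterate_congr_of_le (le_max_right _ _) e2]
  rfl

lemma IsDividedDifference.map {E E' : Type*} [AddCommGroup E] [AddCommGroup E'] (f : E →+ E')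
    {S S' D : ℤ → ℤ → E} (h : IsDividedDifference S S' D) :
    IsDividedDifference (fun p q => f (S p q)) (fun p q => f (S' p q)) (fun p q => f (D p q)) := by
  obtain ⟨h1, h2, h3, M, hM⟩ := h
  refine ⟨h1.map f, h2.map f, h3.map f, M, ?_⟩
  rw [mulDiff_iterate_map, hM, ← mulDiff_iterate_map]
  congr 1
  ext
  simp

/-- Continuations of a family that is linear in a vector are linear in the vector. -/
lemma exists_linear_continuation {E : Type*} [AddCommGroup E] [Module ℂ E]
    (S : ℤ → ℤ → Module.End ℂ E)
    (h : ∀ v, ∃ C, IsContinuation (fun p q => S p q v) C) :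
    ∃ C : ℤ → ℤ → Module.End ℂ E, ∀ v, IsContinuation (fun p q => S p q v) (fun p q => C p q v) := by
  choose C hC using h
  refine ⟨fun p q => ⟨⟨fun v => C v p q, fun v w => ?_⟩, fun r v => ?_⟩, hC⟩
  -- Uniqueness of continuations forces the pointwise choice to be additive and homogeneous.
  · refine congrFun (congrFun (show C (v + w) = C v + C w from (hC (v + w)).unique ?_) p) q
    convert (hC v).add (hC w) using 1
    ext
    simp
  · refine congrFun (congrFun (show C (r • v) = fun p q => r • C v p q from
      (hC (r • v)).unique ?_) p) q
    convert (hC v).map (r • LinearMap.id (R := ℂ) (M := E)).toAddMonoidHom using 1 <;>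
      ext <;> simp

/-- Divided differences of families that are linear in a vector are linear in the vector. -/
lemma exists_linear_dividedDifference {E : Type*} [AddCommGroup E] [Module ℂ E]
    (S S' : ℤ → ℤ → Module.End ℂ E)
    (h : ∀ v, ∃ D, IsDividedDifference (fun p q => S p q v) (fun p q => S' p q v) D) :
    ∃ D : ℤ → ℤ → Module.End ℂ E, ∀ v,
      IsDividedDifference (fun p q => S p q v) (fun p q => S' p q v) (fun p q => D p q v) := by
  choose C hC using h
  refine ⟨fun p q => ⟨⟨fun v => C v p q, fun v w => ?_⟩, fun r v => ?_⟩, hC⟩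
  · refine congrFun (congrFun (show C (v + w) = C v + C w from (hC (v + w)).unique ?_) p) q
    convert (hC v).add (hC w) using 1 <;> ext <;> simp
  · refine congrFun (congrFun (show C (r • v) = fun p q => r • C v p q from
      (hC (r • v)).unique ?_) p) q
    convert (hC v).map (r • LinearMap.id (R := ℂ) (M := E)).toAddMonoidHom using 1 <;>
      ext <;> simp

lemma IsAntisymmetrizer.apply_eq {F : FormalField s} {A : Module.End ℂ (FockSpace s)}
    (h : IsAntisymmetrizer F A) (v : FockSpace s) {C : Fin s → ℤ → ℤ → FockSpace s}
    (hC : ∀ c, IsContinuation (fun p q => psiStar c (p + 1) (F c q v)) (C c)) :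
    A v = ∑ c, contourIntegral (fun p q => psiStar c (p + 1) (F c q v)) (C c) := by
  obtain ⟨D, hD, hA⟩ := h
  rw [hA]
  exact Finset.sum_congr rfl fun c _ => by rw [(hD c v).unique (hC c)]

lemma IsAntisymmetrizer.unique {F : FormalField s} {A A' : Module.End ℂ (FockSpace s)}
    (h : IsAntisymmetrizer F A) (h' : IsAntisymmetrizer F A') : A = A' := by
  obtain ⟨C, hC, hA⟩ := h
  refine LinearMap.ext fun v => ?_
  rw [hA, h'.apply_eq v fun c => hC c v]

/-- All series `F_c(z) |v⟩` are regular. -/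
def IsRegularField (F : FormalField s) : Prop := ∀ c v, RegularSeries fun q => F c q v

lemma IsRegularField.exists_antisymmetrizer {F : FormalField s} (hF : IsRegularField F) :
    ∃ A, IsAntisymmetrizer F A := by
  have h : ∀ c, ∃ C : ℤ → ℤ → Module.End ℂ (FockSpace s), ∀ v,
      IsContinuation (fun p q => psiStar c (p + 1) (F c q v)) (fun p q => C p q v) := fun c =>
    exists_linear_continuation (fun p q => psiStar c (p + 1) * F c q)
      fun v => (hF c v).exists_continuation c
  choose C hC using h
  refine ⟨⟨⟨fun v => ∑ c, contourIntegral
    (fun p q => psiStar c (p + 1) (F c q v)) (fun p q => C c p q v), fun v w => ?_⟩, fun r v => ?_⟩,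
    C, hC, fun v => rfl⟩
  · refine Eq.trans ?_ Finset.sum_add_distrib
    refine Finset.sum_congr rfl fun c _ => ?_
    rw [← (hC c v).contourIntegral_add (hC c w)]
    congr 1 <;> ext <;> simp
  · change ∑ c, contourIntegral (fun p q => psiStar c (p + 1) (F c q (r • v)))
      (fun p q => C c p q (r • v)) = r • ∑ c, contourIntegral
      (fun p q => psiStar c (p + 1) (F c q v)) (fun p q => C c p q v)
    rw [Finset.smul_sum]
    refine Finset.sum_congr rfl fun c _ => ?_
    refine Eq.trans ?_ ((hC c v).map_contourIntegral
      (r • LinearMap.id (R := ℂ) (M := FockSpace s)).toAddMonoidHom)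
    congr 1 <;> ext <;> simp

lemma IsRegularField.psi : IsRegularField (psi (s := s)) := fun c v => .field c v

lemma IsRegularField.fieldMatrixUnit {F : FormalField s} (hF : IsRegularField F) (a b : Fin s) :
    IsRegularField (fieldMatrixUnit a b F) := fun c v => by
  by_cases hc : c = a
  · simpa [SpinCS.fieldMatrixUnit, hc] using hF b v
  · simp only [SpinCS.fieldMatrixUnit, hc, if_false]
    exact RegularSeries.zero

lemma IsRegularField.dividedDifference_eq {F : FormalField s} (hF : IsRegularField F)
    {c b : Fin s} {v : FockSpace s} {D : ℤ → ℤ → FockSpace s}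
    (h : IsDividedDifference (fun m k => SpinCS.psi b m (F c k v))
      (fun m k => SpinCS.psi b k (F c m v)) D) :
    D = psiDividedDifference b fun q => F c q v :=
  h.unique (isDividedDifference_psi (hF c v) b)

/-- The inductive step for iterating `𝒟`. Uniqueness identifies the given divided differences and
continuations with the explicit ones, whose integrals are regular. -/
lemma IsDunklPullback.isRegularField {β : ℂ} {F G : FormalField s} (h : IsDunklPullback β F G)
    (hF : IsRegularField F) : IsRegularField G := by
  obtain ⟨Δ, A, hΔ, hA, hG⟩ := h
  intro c v
  have hD : ∀ b m k, Δ c b m k v = psiDividedDifference b (fun q => F c q v) m k := fun b m k =>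
    congrFun (congrFun (hF.dividedDifference_eq (hΔ c b v)) m) k
  have hC : ∀ b k, ∃ C, IsContinuation (fun p q => psiStar b (p + 1)
      (psiDividedDifference b (fun q => F c q v) q k)) C := fun b k =>
    ((hF c v).psiDividedDifference b k).exists_continuation b
  choose C hC using hC
  have hAr : RegularSeries fun k => A c k v := by
    convert RegularSeries.sum Finset.univ fun b _ => (hF c v).contourIntegral b (hC b) using 1
    ext1 k
    rw [Finset.sum_apply, (hA c k).apply_eq v (C := fun b => C b k) fun b => by
      simpa only [hD] using hC b k]
    simp only [hD]
  convert (hF c v).euler.add (hAr.shift.smul β) using 1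
  ext1 q
  rw [hG]
  rfl

lemma IsRegularField.exists_dunklPullback {F : FormalField s} (hF : IsRegularField F) (β : ℂ) :
    ∃ G, IsDunklPullback β F G := by
  have h : ∀ c b, ∃ D : ℤ → ℤ → Module.End ℂ (FockSpace s), ∀ v,
      IsDividedDifference (fun m k => SpinCS.psi b m (F c k v))
        (fun m k => SpinCS.psi b k (F c m v)) (fun m k => D m k v) := fun c b =>
    exists_linear_dividedDifference (fun m k => SpinCS.psi b m * F c k)
      (fun m k => SpinCS.psi b k * F c m) fun v => ⟨_, isDividedDifference_psi (hF c v) b⟩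
  choose Δ hΔ using h
  have hA : ∀ c k, ∃ A, IsAntisymmetrizer (fun b m => Δ c b m k) A := fun c k =>
    IsRegularField.exists_antisymmetrizer fun b v => by
      simp only [fun m => congrFun (congrFun (hF.dividedDifference_eq (hΔ c b v)) m) k]
      exact (hF c v).psiDividedDifference b k
  choose A hA using hA
  exact ⟨_, Δ, A, hΔ, hA, fun c n => rfl⟩

lemma IsDunklPullback.unique {β : ℂ} {F G G' : FormalField s} (h : IsDunklPullback β F G)
    (h' : IsDunklPullback β F G') : G = G' := by
  obtain ⟨Δ, A, hΔ, hA, hG⟩ := h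
  obtain ⟨Δ', A', hΔ', hA', hG'⟩ := h'
  obtain rfl : Δ = Δ' := by
    ext c b m k : 4
    refine LinearMap.ext fun v => ?_
    exact congrFun (congrFun ((hΔ c b v).unique (hΔ' c b v)) m) k
  obtain rfl : A = A' := by
    ext c k : 2
    exact (hA c k).unique (hA' c k)
  ext c n : 2
  rw [hG, hG']

lemma isRegularField_of_isDunklPullback {β : ℂ} {n : ℕ} {G : ℕ → FormalField s}
    (h0 : G 0 = SpinCS.psi) (hG : ∀ k < n, IsDunklPullback β (G k) (G (k + 1))) {k : ℕ}
    (hk : k ≤ n) : IsRegularField (G k) := by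
  induction k with
  | zero => rw [h0]; exact .psi
  | succ k ih => exact (hG k hk).isRegularField (ih (Nat.le_of_succ_le hk))

theorem existsUnique_isYangianOperator (β : ℂˣ) (a b : Fin s) (n : ℕ) :
    ∃! T : Module.End ℂ (FockSpace s), IsYangianOperator β a b n T := by
  -- Regularity is carried along in a subtype so that `𝒟` can be iterated.
  have hstep : ∀ F : {F : FormalField s // IsRegularField F},
      ∃ G : {F : FormalField s // IsRegularField F}, IsDunklPullback (β : ℂ) F.1 G.1 := fun F => by
    obtain ⟨G, hG⟩ := F.2.exists_dunklPullback (β : ℂ)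
    exact ⟨⟨G, hG.isRegularField F.2⟩, hG⟩
  choose D hD using hstep
  set G : ℕ → {F : FormalField s // IsRegularField F} := fun k => D^[k] ⟨SpinCS.psi, .psi⟩ with hGdef
  have hG : ∀ k, IsDunklPullback (β : ℂ) (G k).1 (G (k + 1)).1 := fun k => by
    simp only [hGdef, Function.iterate_succ_apply']
    exact hD _
  obtain ⟨A, hA⟩ := ((G n).2.fieldMatrixUnit a b).exists_antisymmetrizer
  refine ⟨_, ⟨fun k => (G k).1, A, rfl, fun k _ => hG k, hA, rfl⟩, ?_⟩
  rintro T ⟨G', A', h0, hG', hA', rfl⟩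
  have hGG : ∀ k ≤ n, G' k = (G k).1 := by
    intro k
    induction k with
    | zero => intro _; rw [h0]; rfl
    | succ k ih =>
      intro hk
      have h1 := hG' k hk
      rw [ih (Nat.le_of_succ_le hk)] at h1
      exact h1.unique (hG k)
  rw [hGG n le_rfl] at hA'
  rw [hA'.unique hA]

end

section

/-! ### Words in the fermion modes -/

variable {s : ℕ}

lemma psiWord_zero (c : Fin 0 → Fin s) (n : Fin 0 → ℤ) : psiWord c n = 1 := by
  simp [psiWord]

lemma psiWord_succ {N : ℕ} (c : Fin (N + 1) → Fin s) (n : Fin (N + 1) → ℤ) :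
    psiWord c n = psiWord (c ∘ Fin.succ) (n ∘ Fin.succ) * psi (c 0) (n 0) := by
  simp [psiWord, List.ofFn_succ]

/-- The product of fermion modes with the factor `l` omitted. -/
def psiErase : ∀ {N : ℕ}, (Fin N → Fin s) → (Fin N → ℤ) → Fin N → Module.End ℂ (FockSpace s)
  | _ + 1, c, n, l => psiWord (c ∘ l.succAbove) (n ∘ l.succAbove)

lemma psiErase_zero {N : ℕ} (c : Fin (N + 1) → Fin s) (n : Fin (N + 1) → ℤ) :
    psiErase c n 0 = psiWord (c ∘ Fin.succ) (n ∘ Fin.succ) := by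
  simp [psiErase, Fin.succAbove_zero]

lemma psiErase_succ {N : ℕ} (c : Fin (N + 1) → Fin s) (n : Fin (N + 1) → ℤ) (l : Fin N) :
    psiErase c n l.succ = psiErase (c ∘ Fin.succ) (n ∘ Fin.succ) l * psi (c 0) (n 0) := by
  cases N with
  | zero => exact l.elim0
  | succ N =>
    rw [psiErase, psiWord_succ, psiErase]
    congr 2
    · ext; simp
    · ext; simp

lemma psiErase_congr {N : ℕ} {c d : Fin N → Fin s} {n m : Fin N → ℤ} {l : Fin N}
    (hc : ∀ i, i ≠ l → c i = d i) (hn : ∀ i, i ≠ l → n i = m i) :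
    psiErase c n l = psiErase d m l := by
  cases N with
  | zero => exact l.elim0
  | succ N =>
    rw [psiErase, psiErase]
    congr 1
    · ext1 i; exact hc _ (Fin.succAbove_ne l i)
    · ext1 i; exact hn _ (Fin.succAbove_ne l i)

/-- The factor with index `l` passes the `l` factors to its right, those of smaller index. -/
lemma psiWord_apply_eq_psiErase {N : ℕ} (c : Fin N → Fin s) (n : Fin N → ℤ) (l : Fin N)
    (u : FockSpace s) :
    psiWord c n u = (-1 : ℂ) ^ (l : ℕ) • psiErase c n l (psi (c l) (n l) u) := by
  induction N generalizing u with
  | zero => exact l.elim0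
  | succ N ih =>
    rw [psiWord_succ, Module.End.mul_apply]
    cases l using Fin.cases with
    | zero => rw [psiErase_zero]; simp
    | succ l =>
      rw [ih _ _ l, psiErase_succ, Module.End.mul_apply, psi_psi_apply (c 0), Fin.val_succ, pow_succ]
      simp

/-- Wick contraction: for `m ≤ 0` the mode moves left until `⟨0|` kills it, leaving one contraction
for each factor. -/
lemma leftVacuum_psiWord_psiStar {N : ℕ} (c : Fin N → Fin s) (n : Fin N → ℤ) (b : Fin s) {m : ℤ}
    (hm : m ≤ 0) (u : FockSpace s) : leftVacuum s (psiWord c n (psiStar b m u)) =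
      ∑ l, if c l = b ∧ n l = -m then (-1 : ℂ) ^ (l : ℕ) * leftVacuum s (psiErase c n l u) else 0 := by
  induction N generalizing u with
  | zero => simp [psiWord_zero, leftVacuum_psiStar b m hm]
  | succ N ih =>
    rw [psiWord_succ, Module.End.mul_apply, psi_psiStar_apply, map_add, map_neg, map_add, map_neg,
      ih, Fin.sum_univ_succ, psiErase_zero, add_comm]
    congr 1
    · split_ifs <;> simp
    · rw [← Finset.sum_neg_distrib]
      refine Finset.sum_congr rfl fun l _ => ?_
      rw [psiErase_succ, Module.End.mul_apply, Fin.val_succ, pow_succ, Function.comp_apply,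
        Function.comp_apply]
      split_ifs <;> simp

/-- Negative powers arise only from `etaMul`, hence with a mode `ψ_{b,-m-1}` that anticommutes to
the left and is killed by `⟨0|`. Creation modes of `ψ*` type contract with a factor and shorten the
word, so the induction must allow all word lengths. -/
lemma RegularSeries.leftVacuum_psiWord {φ : ℤ → FockSpace s} (h : RegularSeries φ) {N : ℕ}
    (c : Fin N → Fin s) (n : Fin N → ℤ) {q : ℤ} (hq : q < 0) :
    leftVacuum s (psiWord c n (φ q)) = 0 := by
  have hinl : ∀ {N : ℕ} (c : Fin N → Fin s) (n : Fin N → ℤ) (b : Fin s) (m : ℕ) (u : FockSpace s),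
      leftVacuum s (psiWord c n (SpinCS.create (Sum.inl (b, m)) u)) = 0 := by
    intro N c n b m u
    -- The mode is absorbed into the word as a new rightmost factor with a negative exponent.
    have := leftVacuum_psiWord_of_neg (Fin.cons b c : Fin (N + 1) → Fin s) (Fin.cons (-1 - m) n) u 0
      (by rw [Fin.cons_zero]; omega)
    rwa [psiWord_succ, Fin.cons_zero, Fin.cons_zero, ← create_inl] at this
  induction h generalizing N q with
  | vacuum => simp [Pi.single_eq_of_ne hq.ne]
  | add _ _ h1 h2 => simp [h1 c n hq, h2 c n hq]
  | smul r _ h => simp [h c n hq]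
  | shift _ h => exact h c n (by omega)
  | create g _ h =>
    rcases g with ⟨b, m⟩ | ⟨b, m⟩
    · exact hinl c n b m _
    · rw [create_inr, leftVacuum_psiWord_psiStar c n b (by omega)]
      refine Finset.sum_eq_zero fun l _ => ?_
      cases N with
      | zero => exact l.elim0
      | succ N => rw [psiErase, h _ _ hq, mul_zero, ite_self]
  | eta b j h' h =>
    obtain ⟨Q, hQ⟩ := h'.bounded
    rw [etaMul_eq_sum hQ b j (B := (Q - q + 1).toNat) (by omega), map_sum, map_sum]
    refine Finset.sum_eq_zero fun m _ => ?_
    rw [map_smul, map_smul, hinl, smul_zero]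

lemma RegularSeries.leftVacuum_psiErase {φ : ℤ → FockSpace s} (h : RegularSeries φ) {N : ℕ}
    (c : Fin N → Fin s) (n : Fin N → ℤ) (l : Fin N) {q : ℤ} (hq : q < 0) :
    leftVacuum s (psiErase c n l (φ q)) = 0 := by
  cases N with
  | zero => exact l.elim0
  | succ N => exact h.leftVacuum_psiWord _ _ hq

/-- The matrix elements of the operator `𝒜(F)`. -/
lemma IsAntisymmetrizer.leftVacuum_psiWord {F : FormalField s} {A : Module.End ℂ (FockSpace s)}
    (hA : IsAntisymmetrizer F A) (hF : IsRegularField F) {N : ℕ} (c : Fin N → Fin s)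
    (n : Fin N → ℤ) (v : FockSpace s) : leftVacuum s (psiWord c n (A v)) =
      ∑ l : Fin N, (-1 : ℂ) ^ (l : ℕ) * leftVacuum s (psiErase c n l (F (c l) (n l) v)) := by
  choose K L hKL using fun b => (hF b v).exists_polarDecomposition b
  have hcont := fun b => (hKL b).isContinuation (hF b v)
  have key : ∀ b, leftVacuum s (psiWord c n (contourIntegral
      (fun p q => psiStar b (p + 1) (F b q v))
      (psiStarContinuation b (fun q => F b q v) (K b) (L b)))) =
      ∑ l, if c l = b then
        (-1 : ℂ) ^ (l : ℕ) * leftVacuum s (psiErase c n l (F b (n l) v)) else 0 := by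
    intro b
    obtain ⟨B, hB⟩ := (hcont b).exists_range
    obtain ⟨Q, hQ⟩ := (hF b v).bounded
    have hB' : ∀ i : ℕ, max B (Q + 1).toNat ≤ i →
        (∀ q, psiStarContinuation b (fun q => F b q v) (K b) (L b) i q = 0) ∧
        ∀ p, psiStar b (p + 1) (F b i v) = 0 := fun i hi => hB i ((le_max_left _ _).trans hi)
    -- The first sum vanishes, being built from coefficients `-1 - i < 0` of the regular series `K
    -- i`; the second contains only modes `ψ*_{b,-i}` with `i ≥ 0`.
    rw [IsContinuation.contourIntegral_eq hB', map_add, map_add, map_sum, map_sum, map_sum, map_sum,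
      Finset.sum_eq_zero (s := Finset.range _) fun i _ => ?_, zero_add]
    · have h1 : ∀ i : ℕ, leftVacuum s (psiWord c n (psiStar b (-1 - i + 1) (F b i v))) =
          ∑ l, if c l = b ∧ n l = i then
            (-1 : ℂ) ^ (l : ℕ) * leftVacuum s (psiErase c n l (F b i v)) else 0 := fun i => by
        rw [leftVacuum_psiWord_psiStar c n b (by omega)]
        simp only [show -(-1 - (i : ℤ) + 1) = i by ring]
      simp only [h1]
      rw [Finset.sum_comm]
      refine Finset.sum_congr rfl fun l _ => ?_
      by_cases hl : c l = b
      swap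
      · simp [hl]
      simp only [hl, true_and, if_true]
      -- The sum runs over `i ≥ 0` only; for `n l < 0` the right-hand side vanishes as well, by
      -- regularity of `F`.
      rcases lt_or_ge (n l) 0 with hn | hn
      · rw [(hF b v).leftVacuum_psiErase c n l hn, mul_zero]
        exact Finset.sum_eq_zero fun i _ => if_neg (by omega)
      · obtain ⟨k, hk⟩ := Int.eq_ofNat_of_zero_le hn
        simp only [hk, Nat.cast_inj, Finset.sum_ite_eq, Finset.mem_range]
        split_ifs with h
        · rfl
        · rw [hQ k (by omega), map_zero, map_zero, mul_zero]
    · rw [psiStarContinuation, if_pos (by omega)]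
      exact ((hKL b).regularSeries_left _).leftVacuum_psiWord c n (by omega)
  rw [hA.apply_eq v hcont, map_sum, map_sum, Finset.sum_congr rfl fun b _ => key b, Finset.sum_comm]
  simp

/-! ### Coefficients of polynomials with integral exponents -/

/-- The coefficient of `x^n`, which is zero if `n` has a negative component. -/
def intCoeff {N : ℕ} (n : Fin N → ℤ) : MvPolynomial (Fin N) ℂ →ₗ[ℂ] ℂ :=
  if ∀ i, 0 ≤ n i then
    MvPolynomial.lcoeff ℂ (Finsupp.equivFunOnFinite.symm fun i => (n i).toNat) else 0

section IntCoeff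

variable {N : ℕ}

lemma intCoeff_natCast (m : Fin N →₀ ℕ) (f : MvPolynomial (Fin N) ℂ) :
    intCoeff (fun i => (m i : ℤ)) f = MvPolynomial.coeff m f := by
  rw [intCoeff, if_pos fun i => by omega, MvPolynomial.lcoeff_apply]
  congr 1
  ext i
  simp

lemma intCoeff_of_neg {n : Fin N → ℤ} {i : Fin N} (hi : n i < 0) (f : MvPolynomial (Fin N) ℂ) :
    intCoeff n f = 0 := by
  rw [intCoeff, if_neg fun h => absurd (h i) (not_le.mpr hi)]
  rfl

lemma exists_eq_natCast_or_neg (n : Fin N → ℤ) :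
    (∃ m : Fin N →₀ ℕ, n = fun i => (m i : ℤ)) ∨ ∃ i, n i < 0 := by
  by_cases h : ∃ i, n i < 0
  · exact Or.inr h
  · push Not at h
    refine Or.inl ⟨Finsupp.equivFunOnFinite.symm fun i => (n i).toNat, ?_⟩
    ext i
    simp [h i]

lemma ext_intCoeff {f g : MvPolynomial (Fin N) ℂ} (h : ∀ n, intCoeff n f = intCoeff n g) :
    f = g := by
  ext m
  rw [← intCoeff_natCast, ← intCoeff_natCast, h]

lemma intCoeff_X_mul (n : Fin N → ℤ) (j : Fin N) (f : MvPolynomial (Fin N) ℂ) :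
    intCoeff n (MvPolynomial.X j * f) = intCoeff (n - Pi.single j 1) f := by
  rcases exists_eq_natCast_or_neg n with ⟨m, rfl⟩ | ⟨i, hi⟩
  · rw [intCoeff_natCast, MvPolynomial.coeff_X_mul']
    split_ifs with hj
    · rw [← intCoeff_natCast]
      congr 2
      ext i
      rw [Finsupp.mem_support_iff] at hj
      by_cases hij : i = j
      · subst hij
        simp
        omega
      · simp [hij]
    · rw [intCoeff_of_neg (i := j)]
      simp only [Finsupp.mem_support_iff, not_not] at hj
      simp [hj]
  · rw [intCoeff_of_neg hi, intCoeff_of_neg (i := i)]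
    by_cases hij : i = j
    · subst hij; simp; omega
    · simpa [hij] using hi

lemma intCoeff_X_mul_pderiv (n : Fin N → ℤ) (j : Fin N) (f : MvPolynomial (Fin N) ℂ) :
    intCoeff n (MvPolynomial.X j * MvPolynomial.pderiv j f) = n j * intCoeff n f := by
  rcases exists_eq_natCast_or_neg n with ⟨m, rfl⟩ | ⟨i, hi⟩
  · rw [intCoeff_natCast, intCoeff_natCast]
    induction f using MvPolynomial.induction_on' with
    | monomial m' a =>
      rw [MvPolynomial.X_mul_pderiv_monomial, MvPolynomial.coeff_smul, MvPolynomial.coeff_monomial]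
      split_ifs with h
      · subst h; simp
      · simp
    | add p q hp hq => simp [mul_add, hp, hq]
  · rw [intCoeff_of_neg hi, intCoeff_of_neg hi, mul_zero]

lemma intCoeff_rename (n : Fin N → ℤ) (σ : Equiv.Perm (Fin N)) (f : MvPolynomial (Fin N) ℂ) :
    intCoeff n (MvPolynomial.rename σ f) = intCoeff (n ∘ σ) f := by
  rcases exists_eq_natCast_or_neg n with ⟨m, rfl⟩ | ⟨i, hi⟩
  · have : m = Finsupp.mapDomain σ (Finsupp.equivFunOnFinite.symm (m ∘ σ)) := by
      ext i
      rw [Finsupp.mapDomain_equiv_apply]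
      simp
    rw [intCoeff_natCast]
    nth_rw 1 [this]
    rw [MvPolynomial.coeff_rename_mapDomain _ σ.injective, ← intCoeff_natCast]
    rfl
  · rw [intCoeff_of_neg hi, intCoeff_of_neg (i := σ.symm i) (by simpa using hi)]

lemma intCoeff_bounded (f : MvPolynomial (Fin N) ℂ) {n : Fin N → ℤ} {i : Fin N}
    (hi : (f.totalDegree : ℤ) < n i) : intCoeff n f = 0 := by
  rcases exists_eq_natCast_or_neg n with ⟨m, rfl⟩ | ⟨k, hk⟩
  · rw [intCoeff_natCast]
    by_contra h
    have h1 := MvPolynomial.le_totalDegree (MvPolynomial.mem_support_iff.mpr h)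
    have h2 : m i ≤ m.sum fun _ e => e := by
      rw [Finsupp.sum_fintype _ _ fun _ => rfl]
      exact Finset.single_le_sum (fun _ _ => Nat.zero_le _) (Finset.mem_univ i)
    exact absurd (h2.trans h1) (not_le.mpr (Int.ofNat_lt.mp hi))
  · exact intCoeff_of_neg hk f

lemma intCoeff_matrixElement (n : Fin N → ℤ) (v : FockSpace s) (c : Fin N → Fin s) :
    intCoeff n (matrixElement N v c) = leftVacuum s (psiWord c n v) := by
  rcases exists_eq_natCast_or_neg n with ⟨m, rfl⟩ | ⟨i, hi⟩
  · rw [intCoeff_natCast, coeff_matrixElement]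
  · rw [intCoeff_of_neg hi, leftVacuum_psiWord_of_neg c n v i hi]

end IntCoeff

end

section

/-! ### The finite system -/

variable {s N : ℕ}

/-- Both modes are pulled to the right end with the same signs in the two words, and there they
anticommute. -/
lemma psiWord_comp_swap (c : Fin N → Fin s) (n : Fin N → ℤ) {i j : Fin N} (hij : i ≠ j)
    (u : FockSpace s) :
    psiWord (c ∘ Equiv.swap i j) (n ∘ Equiv.swap i j) u = -psiWord c n u := by
  cases N with
  | zero => exact i.elim0
  | succ N =>
    obtain ⟨l, rfl⟩ := Fin.exists_succAbove_eq hij.symm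
    have hl : ∀ m, m ≠ l → Equiv.swap i (i.succAbove l) (i.succAbove m) = i.succAbove m :=
      fun m hm => Equiv.swap_apply_of_ne_of_ne (Fin.succAbove_ne i m)
        fun h => hm (Fin.succAbove_right_injective h)
    rw [psiWord_apply_eq_psiErase _ _ i, psiWord_apply_eq_psiErase c n i, psiErase, psiErase,
      psiWord_apply_eq_psiErase _ _ l,
      psiWord_apply_eq_psiErase (c ∘ i.succAbove) (n ∘ i.succAbove) l,
      psiErase_congr (l := l) (d := c ∘ i.succAbove) (m := n ∘ i.succAbove)
        (fun m hm => by simp [hl m hm]) (fun m hm => by simp [hl m hm])]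
    simp only [Function.comp_apply, Equiv.swap_apply_left, Equiv.swap_apply_right]
    rw [psi_psi_apply, map_neg, smul_neg, smul_neg]

theorem matrixElement_mem_skewInvariants (v : FockSpace s) :
    matrixElement N v ∈ skewInvariants s N := fun i j hij c => ext_intCoeff fun n => by
  rw [intCoeff_rename, intCoeff_matrixElement, psiWord_comp_swap c n hij, map_neg, map_neg,
    intCoeff_matrixElement]

/-! ### Equivariance of the Dunkl operators under permutations of the variables. -/

lemma exchangeQuotient_rename {i j : Fin N} (hij : i ≠ j) (σ : Equiv.Perm (Fin N))
    (f : MvPolynomial (Fin N) ℂ) : MvPolynomial.rename σ (exchangeQuotient i j hij f) =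
      exchangeQuotient (σ i) (σ j) (σ.injective.ne hij) (MvPolynomial.rename σ f) := by
  apply mul_left_cancel₀ (X_sub_X_ne_zero (σ.injective.ne hij))
  change _ = _ * exchangeQuotientFun _ _ _
  rw [← exchangeQuotientFun_spec]
  have := congrArg (MvPolynomial.rename σ) (exchangeQuotientFun_spec i j f)
  rw [map_mul, map_sub, map_sub, MvPolynomial.rename_X, MvPolynomial.rename_X,
    MvPolynomial.rename_rename] at this
  change (MvPolynomial.X (σ i) - MvPolynomial.X (σ j)) *
    MvPolynomial.rename σ (exchangeQuotientFun i j f) = _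
  rw [← this, MvPolynomial.rename_rename]
  congr 3
  ext k
  simp [Equiv.swap_apply_def, apply_ite σ]

lemma pderiv_rename_perm (i : Fin N) (σ : Equiv.Perm (Fin N)) (f : MvPolynomial (Fin N) ℂ) :
    MvPolynomial.rename σ (MvPolynomial.X i * MvPolynomial.pderiv i f) =
      MvPolynomial.X (σ i) * MvPolynomial.pderiv (σ i) (MvPolynomial.rename σ f) :=
  ext_intCoeff fun n => by
    rw [intCoeff_rename, intCoeff_X_mul_pderiv, intCoeff_X_mul_pderiv, intCoeff_rename]
    rfl

lemma dunklPoly_apply (β : ℂ) (i : Fin N) (f : MvPolynomial (Fin N) ℂ) :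
    dunklPoly β i f = MvPolynomial.X i * MvPolynomial.pderiv i f +
      β • ∑ j : {j : Fin N // j ≠ i}, MvPolynomial.X i * exchangeQuotient i j.1 j.2.symm f := by
  simp [dunklPoly]

lemma dunklPoly_rename (β : ℂ) (i : Fin N) (σ : Equiv.Perm (Fin N))
    (f : MvPolynomial (Fin N) ℂ) : MvPolynomial.rename σ (dunklPoly β i f) =
      dunklPoly β (σ i) (MvPolynomial.rename σ f) := by
  rw [dunklPoly_apply, dunklPoly_apply, map_add, pderiv_rename_perm, map_smul, map_sum]
  congr 2
  refine Fintype.sum_equiv (σ.subtypeEquiv fun j => by simp) _ _ fun j => ?_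
  rw [map_mul, MvPolynomial.rename_X, exchangeQuotient_rename]
  rfl

lemma dunkl_pow_apply (β : ℂ) (i : Fin N) (n : ℕ) (f : SpinTensor s N) (c : Fin N → Fin s) :
    (dunkl s β i ^ n) f c = (dunklPoly β i ^ n) (f c) := by
  induction n generalizing f with
  | zero => rfl
  | succ n ih => rw [pow_succ, Module.End.mul_apply, ih, pow_succ, Module.End.mul_apply]; rfl

lemma dunklPoly_pow_rename (β : ℂ) (i : Fin N) (n : ℕ) (σ : Equiv.Perm (Fin N))
    (f : MvPolynomial (Fin N) ℂ) : MvPolynomial.rename σ ((dunklPoly β i ^ n) f) =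
      (dunklPoly β (σ i) ^ n) (MvPolynomial.rename σ f) := by
  induction n generalizing f with
  | zero => rfl
  | succ n ih =>
    rw [pow_succ, Module.End.mul_apply, ih, pow_succ, Module.End.mul_apply, dunklPoly_rename]

/-- The geometric series, read off recursively from the coefficients of `(β - D X) P = 1`. -/
lemma coeff_invOfUnit_linear {R : Type*} [Ring R] [Algebra ℂ R] (β : ℂˣ) (D : R) (n : ℕ) :
    PowerSeries.coeff n (PowerSeries.invOfUnit
      (PowerSeries.C (algebraMap ℂ R β) - PowerSeries.C D * PowerSeries.X)
      (Units.map (algebraMap ℂ R).toMonoidHom β)) = ((β : ℂ) ^ (n + 1))⁻¹ • D ^ n := by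
  set P := PowerSeries.invOfUnit
      (PowerSeries.C (algebraMap ℂ R β) - PowerSeries.C D * PowerSeries.X)
      (Units.map (algebraMap ℂ R).toMonoidHom β) with hP
  have hmul := PowerSeries.mul_invOfUnit
    (PowerSeries.C (algebraMap ℂ R β) - PowerSeries.C D * PowerSeries.X)
    (Units.map (algebraMap ℂ R).toMonoidHom β) (by simp)
  rw [← hP, sub_mul, mul_assoc] at hmul
  have hβ : (β : ℂ) ≠ 0 := β.ne_zero
  have key : ∀ x y : R, algebraMap ℂ R β * x = y → x = (β : ℂ)⁻¹ • y := fun x y h => by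
    rw [← h, ← Algebra.smul_def, inv_smul_smul₀ hβ]
  induction n with
  | zero =>
    have := congrArg (PowerSeries.coeff 0) hmul
    rw [map_sub, PowerSeries.coeff_C_mul, PowerSeries.coeff_C_mul, PowerSeries.coeff_zero_X_mul,
      mul_zero, sub_zero, PowerSeries.coeff_zero_one] at this
    rw [key _ _ this, zero_add, pow_one, pow_zero]
  | succ n ih =>
    have := congrArg (PowerSeries.coeff (n + 1)) hmul
    rw [map_sub, PowerSeries.coeff_C_mul, PowerSeries.coeff_C_mul, PowerSeries.coeff_succ_X_mul,
      ih, PowerSeries.coeff_one, if_neg (Nat.succ_ne_zero n), sub_eq_zero] at this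
    rw [key _ _ this, mul_smul_comm, smul_smul, ← pow_succ', ← mul_inv, ← pow_succ']

lemma yangianGenerator_eq (β : ℂˣ) (a b : Fin s) (n : ℕ) : yangianGenerator N β a b n =
    ((β : ℂ) ^ n)⁻¹ • ∑ i : Fin N, matrixUnit a b i * dunkl s (β : ℂ) i ^ n := by
  have h0 : PowerSeries.coeff (n + 1)
      (if a = b then 1 else 0 : (Module.End ℂ (SpinTensor s N))⟦X⟧) = 0 := by
    split_ifs
    · rw [PowerSeries.coeff_one, if_neg (Nat.succ_ne_zero n)]
    · exact map_zero _
  rw [yangianGenerator, yangianSeries, map_add, h0, zero_add, map_sum, Finset.smul_sum]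
  refine Finset.sum_congr rfl fun i _ => ?_
  rw [PowerSeries.coeff_C_mul, PowerSeries.coeff_succ_X_mul, coeff_invOfUnit_linear,
    smul_mul_assoc, mul_smul_comm, smul_smul, pow_succ', mul_inv, mul_inv_cancel_left₀ β.ne_zero]

lemma yangianGenerator_apply (β : ℂˣ) (a b : Fin s) (n : ℕ) (f : SpinTensor s N)
    (c : Fin N → Fin s) : yangianGenerator N β a b n f c = ((β : ℂ) ^ n)⁻¹ • ∑ i : Fin N,
      if c i = a then (dunklPoly (β : ℂ) i ^ n) (f (Function.update c i b)) else 0 := by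
  rw [yangianGenerator_eq, LinearMap.smul_apply, Pi.smul_apply, LinearMap.sum_apply,
    Finset.sum_apply]
  congr 1
  refine Finset.sum_congr rfl fun i _ => ?_
  rw [← dunkl_pow_apply]
  rfl

/-- Exchanging `i` and `j` in both variables and spins carries the `k`-th summand to the summand of
index `swap i j k`, so the sum is only reordered. -/
theorem yangianGenerator_mem_skewInvariants (β : ℂˣ) (a b : Fin s) (n : ℕ) {f : SpinTensor s N}
    (hf : f ∈ skewInvariants s N) : yangianGenerator N β a b n f ∈ skewInvariants s N := by
  intro i j hij c
  rw [yangianGenerator_apply, yangianGenerator_apply, map_smul, ← smul_neg, map_sum,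
    ← Finset.sum_neg_distrib]
  congr 1
  refine Fintype.sum_equiv (Equiv.swap i j) _ _ fun k => ?_
  rw [Function.comp_apply]
  split_ifs with h
  · rw [dunklPoly_pow_rename, ← map_neg, ← hf i j hij,
      Function.update_comp_eq_of_injective _ (Equiv.swap i j).injective]
  · simp

/-! ### The Dunkl operator on matrix elements -/

/-- Here `p` is the exponent of `x_l` and `q` that of `x_j`, so `mulDiff` is multiplication by `x_j
- x_l`. -/
lemma intCoeff_exchangeQuotient {j l : Fin N} (hjl : j ≠ l) (f : MvPolynomial (Fin N) ℂ)
    (n : Fin N → ℤ) (p q : ℤ) :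
    mulDiff (fun p q => intCoeff (Function.update (Function.update n l p) j q)
      (exchangeQuotient j l hjl f)) p q =
    intCoeff (Function.update (Function.update n l p) j q) f -
      intCoeff (Function.update (Function.update n l q) j p) f := by
  have h : f - MvPolynomial.rename (Equiv.swap j l) f =
      (MvPolynomial.X j - MvPolynomial.X l) * exchangeQuotient j l hjl f :=
    exchangeQuotientFun_spec j l f
  have h2 := congrArg (intCoeff (Function.update (Function.update n l p) j q)) h
  rw [map_sub, intCoeff_rename, sub_mul, map_sub, intCoeff_X_mul, intCoeff_X_mul] at h2
  rw [mulDiff]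
  convert h2.symm using 2
  · congr 2
    ext i
    by_cases hi : i = j
    · subst hi; simp
    · simp [hi]
  · congr 2
    ext i
    by_cases hi : i = j
    · subst hi; simp [hjl]
    · by_cases hl : i = l
      · subst hl; simp [hi]
      · simp [hi, hl]
  · congr 2
    ext i
    by_cases hi : i = j
    · subst hi; simp [hjl.symm]
    · by_cases hl : i = l
      · subst hl; simp [hi]
      · simp [hi, hl, Equiv.swap_apply_of_ne_of_ne]

lemma isExpansion_intCoeff {j l : Fin N} (hjl : j ≠ l) (f : MvPolynomial (Fin N) ℂ)
    (n : Fin N → ℤ) :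
    IsExpansion fun p q => intCoeff (Function.update (Function.update n l p) j q) f :=
  .of_bounded (X := f.totalDegree) (Y := f.totalDegree)
    (fun p q hp => intCoeff_bounded f (i := l) (by simpa [hjl.symm] using hp))
    (fun p q hq => intCoeff_bounded f (i := j) (by simpa using hq))

lemma psiErase_apply_psi (c : Fin N → Fin s) (n : Fin N → ℤ) (l : Fin N) (p : ℤ)
    (u : FockSpace s) : (-1 : ℂ) ^ (l : ℕ) * leftVacuum s (psiErase c n l (psi (c l) p u)) =
      leftVacuum s (psiWord c (Function.update n l p) u) := by
  rw [psiWord_apply_eq_psiErase c _ l, map_smul, smul_eq_mul, Function.update_self,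
    psiErase_congr (fun _ _ => rfl) fun i hi => (Function.update_of_ne hi _ _).symm]

/-- The pullback `𝒟` acts on matrix elements as the Dunkl operator. -/
lemma IsDunklPullback.intCoeff_dunklPoly {β : ℂ} {F G : FormalField s}
    (h : IsDunklPullback β F G) (hF : IsRegularField F) (v : FockSpace s) (j : Fin N)
    (c : Fin N → Fin s) (f : MvPolynomial (Fin N) ℂ)
    (hf : ∀ n, intCoeff n f =
      (-1 : ℂ) ^ (j : ℕ) * leftVacuum s (psiErase c n j (F (c j) (n j) v))) (n : Fin N → ℤ) :
    intCoeff n (dunklPoly β j f) =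
      (-1 : ℂ) ^ (j : ℕ) * leftVacuum s (psiErase c n j (G (c j) (n j) v)) := by
  cases N with
  | zero => exact j.elim0
  | succ N =>
    obtain ⟨Δ, A, hΔ, hA, hG⟩ := h
    have hreg : ∀ k, IsRegularField fun b m => Δ (c j) b m k := fun k b v => by
      simp only [fun m => congrFun (congrFun (hF.dividedDifference_eq (hΔ (c j) b v)) m) k]
      exact (hF (c j) v).psiDividedDifference b k
    have hmul : ∀ b, mulDiff (fun p q => Δ (c j) b p q v) =
        psiCommutator b fun q => F (c j) q v := fun b => by
      rw [hF.dividedDifference_eq (hΔ (c j) b v), mulDiff_psiDividedDifference (hF (c j) v)]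
    have hE : ∀ l : Fin N, ∀ p q, intCoeff (Function.update (Function.update n (j.succAbove l) p) j q)
        (exchangeQuotient j (j.succAbove l) (Fin.succAbove_ne j l).symm f) =
        (-1 : ℂ) ^ (j : ℕ) * ((-1 : ℂ) ^ (l : ℕ) * leftVacuum s (psiErase (c ∘ j.succAbove)
          (n ∘ j.succAbove) l (Δ (c j) (c (j.succAbove l)) p q v))) := by
      intro l
      set b := c (j.succAbove l)
      -- The matrix element in which the factors `j` and `j.succAbove l` have been removed, with the
      -- signs of both removals.
      set μ : FockSpace s →+ ℂ := (((-1 : ℂ) ^ (j : ℕ) * (-1 : ℂ) ^ (l : ℕ)) •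
        (leftVacuum s ∘ₗ psiErase (c ∘ j.succAbove) (n ∘ j.succAbove) l)).toAddMonoidHom with hμ
      have hμ' : ∀ u, μ u = (-1 : ℂ) ^ (j : ℕ) * ((-1 : ℂ) ^ (l : ℕ) * leftVacuum s (psiErase
          (c ∘ j.succAbove) (n ∘ j.succAbove) l u)) := fun u => by
        simp [hμ, mul_assoc]
      have hμψ : ∀ p q, μ (psi b p (F (c j) q v)) =
          intCoeff (Function.update (Function.update n (j.succAbove l) p) j q) f := fun p q => by
        have hcomp : Function.update (n ∘ j.succAbove) l p =
            Function.update (Function.update n (j.succAbove l) p) j q ∘ j.succAbove := by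
          ext i
          by_cases hi : i = l
          · subst hi; simp [Fin.succAbove_ne]
          · simp [hi, Fin.succAbove_ne]
        rw [hμ', hf, psiErase, ← hcomp, Function.update_self]
        congr 1
        exact psiErase_apply_psi (c ∘ j.succAbove) (n ∘ j.succAbove) l p _
      -- Both sides are expansions with the same product by `x_j - x_l`, so they coincide.
      have heq : (fun p q => intCoeff (Function.update (Function.update n (j.succAbove l) p) j q)
          (exchangeQuotient j (j.succAbove l) (Fin.succAbove_ne j l).symm f)) =
          fun p q => μ (Δ (c j) b p q v) := by
        refine (isExpansion_intCoeff (Fin.succAbove_ne j l).symm _ n).eq_of_iterate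
          ((hΔ (c j) b v).2.2.1.map μ) (M := 1) ?_
        rw [Function.iterate_one, mulDiff_map, hmul]
        ext p q
        rw [intCoeff_exchangeQuotient, psiCommutator, map_sub, hμψ, hμψ]
      intro p q
      rw [← hμ']
      exact congrFun (congrFun heq p) q
    -- The antisymmetrizer acts on the word with factor `j` removed; each remaining factor `l` gives
    -- the exchange term of the pair `(j, l)`.
    have hA' := (hA (c j) (n j - 1)).leftVacuum_psiWord (hreg _) (c ∘ j.succAbove)
      (n ∘ j.succAbove) v
    rw [hG, dunklPoly_apply, map_add, intCoeff_X_mul_pderiv, hf, map_smul, map_sum,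
      ← Equiv.sum_comp (finSuccAboveEquiv j), LinearMap.add_apply, map_add, map_add,
      mul_add]
    congr 1
    · simp
      ring
    · rw [LinearMap.smul_apply, map_smul, map_smul, smul_eq_mul, smul_eq_mul, mul_left_comm]
      congr 1
      change _ = _ * leftVacuum s (psiWord (c ∘ j.succAbove) (n ∘ j.succAbove) _)
      rw [hA', Finset.mul_sum]
      refine Finset.sum_congr rfl fun l _ => ?_
      rw [intCoeff_X_mul]
      -- The exponent `n j - 1` reflects the factor `x_j` in the Dunkl operator and the factor `z`
      -- in `𝒟`.
      refine Eq.trans ?_ (hE l (n (j.succAbove l)) (n j - 1))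
      rw [Function.update_eq_self]
      congr 2
      ext i
      by_cases hi : i = j
      · subst hi; simp
      · simp [hi]

lemma intCoeff_dunklPoly_pow {β : ℂ} {n : ℕ} {G : ℕ → FormalField s}
    (h0 : G 0 = psi) (hG : ∀ k < n, IsDunklPullback β (G k) (G (k + 1))) (v : FockSpace s)
    (j : Fin N) (c : Fin N → Fin s) {k : ℕ} (hk : k ≤ n) (m : Fin N → ℤ) :
    intCoeff m ((dunklPoly β j ^ k) (matrixElement N v c)) =
      (-1 : ℂ) ^ (j : ℕ) * leftVacuum s (psiErase c m j (G k (c j) (m j) v)) := by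
  induction k generalizing m with
  | zero =>
    rw [pow_zero, Module.End.one_apply, intCoeff_matrixElement, h0, psiErase_apply_psi,
      Function.update_eq_self]
  | succ k ih =>
    rw [pow_succ', Module.End.mul_apply]
    exact (hG k hk).intCoeff_dunklPoly (isRegularField_of_isDunklPullback h0 hG (by omega)) v j c _
      (fun m => ih (by omega) m) m

theorem IsYangianOperator.matrixElement_apply {β : ℂˣ} {a b : Fin s} {n : ℕ}
    {T : Module.End ℂ (FockSpace s)} (h : IsYangianOperator β a b n T) (v : FockSpace s) :
    matrixElement N (T v) = yangianGenerator N β a b n (matrixElement N v) := by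
  obtain ⟨G, A, h0, hG, hA, rfl⟩ := h
  have hreg := isRegularField_of_isDunklPullback h0 hG le_rfl
  refine funext fun c => ext_intCoeff fun m => ?_
  rw [intCoeff_matrixElement, LinearMap.smul_apply, map_smul, map_smul,
    hA.leftVacuum_psiWord (hreg.fieldMatrixUnit a b), yangianGenerator_apply, map_smul, map_sum]
  congr 1
  refine Finset.sum_congr rfl fun l _ => ?_
  by_cases hl : c l = a
  -- Changing the spin label at `l` from `a` to `b` does not affect the word from which factor `l`
  -- is erased.
  · rw [if_pos hl, intCoeff_dunklPoly_pow h0 hG v l _ le_rfl, Function.update_self, fieldMatrixUnit,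
      if_pos hl, psiErase_congr (fun i hi => (Function.update_of_ne hi b c).symm) fun _ _ => rfl]
  · simp [fieldMatrixUnit, hl]

end

end SpinCS

end

theorem proposition4p2 (s : ℕ) (β : ℂˣ) (a b : Fin s) (n : ℕ) :
    (∃! T : Module.End ℂ (SpinCS.FockSpace s), SpinCS.IsYangianOperator β a b n T) ∧
    (∀ (N : ℕ) (f : SpinCS.SpinTensor s N), f ∈ SpinCS.skewInvariants s N →
      SpinCS.yangianGenerator N β a b n f ∈ SpinCS.skewInvariants s N) ∧
    ∀ T : Module.End ℂ (SpinCS.FockSpace s), SpinCS.IsYangianOperator β a b n T →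
      ∀ (N : ℕ) (v : SpinCS.FockSpace s),
        SpinCS.matrixElement N v ∈ SpinCS.skewInvariants s N ∧
        SpinCS.matrixElement N (T v) =
          SpinCS.yangianGenerator N β a b n (SpinCS.matrixElement N v) :=
  ⟨SpinCS.existsUnique_isYangianOperator β a b n,
    fun _ _ hf => SpinCS.yangianGenerator_mem_skewInvariants β a b n hf,
    fun _ hT _ v => ⟨SpinCS.matrixElement_mem_skewInvariants v, hT.matrixElement_apply v⟩⟩
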